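/- Let $\Bbbk$ be a field and let $H$ be a Hopf algebra over $\Bbbk$ with coproduct $h\mapsto h_{(1)}\otimes h_{(2)}$, counit $\epsilon$ and antipode $S$. A quasi-Yetter–Drinfeld (quasi-YD) module over $H$ is a left $H$-module $V$ with a linear map (quasicoaction) $\delta\colon V\to H\otimes V$, $\delta(v)=v^{[-1]}\otimes v^{[0]}$, such that $$(h_{(1)}\triangleright v)^{[-1]}h_{(2)}\otimes(h_{(1)}\triangleright v)^{[0]}=h_{(1)}v^{[-1]}\otimes h_{(2)}\triangleright v^{[0]}\qquad(h\in H,\ v\in V).$$ It is a Yetter–Drinfeld (YD) module if moreover $\delta$ is a (coassociative, counital) coaction. For a quasi-YD module $(V,\delta)$ let $\widetilde A(V,\delta)$ be the algebra generated by the space $V$, the algebra $H$ and the space $V^*$ with relations $hv=(h_{(1)}\triangleright v)h_{(2)}$, $fh=h_{(1)}(f\triangleleft h_{(2)})$, $fv-vf=v^{[-1]}\langle f,v^{[0]}\rangle$, where $\langle f\triangleleft h,v\rangle=\langle f,h\triangleright v\rangle$. A triangular ideal is a two-sided ideal of the form $I^-\,H\,T(V^*)+T(V)\,H\,I^+$ with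 subspaces $I^-\subseteq T^{>0}(V)$, $I^+\subseteq T^{>0}(V^*)$. Let $I(V,\delta)\subseteq T(V)$ be the component $I^-$ of the largest triangular ideal (the sum of all triangular ideals). Let $(V,\delta_V)$, $(W,\delta_W)$ be quasi-YD modules. $V$ is a subquotient of $W$ via $V\xrightarrow{\mu}W\xrightarrow{\nu}V$ if $\mu,\nu$ are $H$-module maps and $\delta_V=(\mathrm{id}_H\otimes\nu)\circ\delta_W\circ\mu$; it is a perfect subquotient if, in addition, $I(V,\delta_V)=T(\mu)^{-1}I(W,\delta_W)$, where $T(\mu)\colon T(V)\to T(W)$ is the algebra map induced by $\mu$. **Theorem.** Let $(V,\delta)$ be a quasi-YD module over $H$. 1. The space $Y(V)=H\otimes V$ with action $h\triangleright(x\otimes v)=h_{(1)}\,x\,S(h_{(3)})\otimes h_{(2)}\triangleright v$ and coaction $x\otimes v\mapsto x_{(1)}\otimes x_{(2)}\otimes v$ is a YD module over $H$, and $V$ is a perfect subquotient of $Y(V)$ via the maps $V\xrightarrow{\ \delta\ }Y(V)\xrightarrow{\ \epsilon\otimes\mathrm{id}_V\ }V$. 2. If $V$ is finite-dimensional and either $\dim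 H<\infty$ or $H$ is commutative and cocommutative, then there is a finite-dimensional YD module $Y$ over $H$ such that $V$ is a perfect subquotient of $Y$ (via some maps $V\to Y\to V$). -/

import Mathlib

open scoped TensorProduct

universe u v w w'

noncomputable section

namespace BraidedDoubles

/-- The raw data on a vector space `V`: a linear map `H → End V` (the candidate left action
`h ▷ v = act h v`) and a linear map `δ : V → H ⊗ V` (a quasicoaction). The axioms are imposed in
`IsQuasiYD` and `IsYD`. -/
structure ActionCoaction (k : Type u) (H : Type v) (V : Type w) [Field k] [Ring H]
    [HopfAlgebra k H] [AddCommGroup V] [Module k V] where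
  /-- the action -/
  act : H →ₗ[k] Module.End k V
  /-- the quasicoaction -/
  coact : V →ₗ[k] H ⊗[k] V

variable {k : Type u} {H : Type v} {V : Type w} {W : Type w'} [Field k] [Ring H] [HopfAlgebra k H]
  [AddCommGroup V] [Module k V] [AddCommGroup W] [Module k W]

namespace ActionCoaction

/-- For fixed `v`, the map `a ⊗ b ↦ (a ▷ v)^[-1] b ⊗ (a ▷ v)^[0]`. -/
def compatLeft (S : ActionCoaction k H V) (x : V) : H ⊗[k] H →ₗ[k] H ⊗[k] V :=
  TensorProduct.lift <| LinearMap.mk₂ k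
    (fun a b => (LinearMap.mulRight k b).rTensor V (S.coact (S.act a x)))
    (by intros; simp) (by intros; simp)
    (by
      intro a b b'
      have h : LinearMap.mulRight k (b + b') = LinearMap.mulRight k b + LinearMap.mulRight k b' := by
        ext; simp [mul_add]
      rw [h, LinearMap.rTensor_add, LinearMap.add_apply])
    (by
      intro c a b
      have h : LinearMap.mulRight k (c • b) = c • LinearMap.mulRight k b := by
        ext; simp
      rw [h, LinearMap.rTensor_smul, LinearMap.smul_apply])

/-- For fixed `v`, the map `a ⊗ b ↦ a v^[-1] ⊗ b ▷ v^[0]`. -/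
def compatRight (S : ActionCoaction k H V) (x : V) : H ⊗[k] H →ₗ[k] H ⊗[k] V :=
  TensorProduct.lift <| LinearMap.mk₂ k
    (fun a b => TensorProduct.map (LinearMap.mulLeft k a) (S.act b) (S.coact x))
    (by
      intro a a' b
      have h : LinearMap.mulLeft k (a + a') = LinearMap.mulLeft k a + LinearMap.mulLeft k a' := by
        ext; simp [add_mul]
      rw [h, TensorProduct.map_add_left, LinearMap.add_apply])
    (by
      intro c a b
      have h : LinearMap.mulLeft k (c • a) = c • LinearMap.mulLeft k a := by
        ext; simp
      rw [h, TensorProduct.map_smul_left, LinearMap.smul_apply])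
    (by intros; rw [map_add, TensorProduct.map_add_right, LinearMap.add_apply])
    (by intros; rw [map_smul, TensorProduct.map_smul_right, LinearMap.smul_apply])

/-- Quasi-Yetter–Drinfeld modules: `V` is a left `H`-module and
`(h₁ ▷ v)^[-1] h₂ ⊗ (h₁ ▷ v)^[0] = h₁ v^[-1] ⊗ h₂ ▷ v^[0]`. -/
structure IsQuasiYD (S : ActionCoaction k H V) : Prop where
  act_one : S.act 1 = 1
  act_mul : ∀ g h : H, S.act (g * h) = S.act g * S.act h
  compat : ∀ (h : H) (x : V),
    S.compatLeft x (Coalgebra.comul (R := k) h) = S.compatRight x (Coalgebra.comul (R := k) h)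

/-- Yetter–Drinfeld modules: quasi-Yetter–Drinfeld modules whose quasicoaction is a coaction. -/
structure IsYD (S : ActionCoaction k H V) : Prop extends IsQuasiYD S where
  coassoc : ∀ x : V,
    TensorProduct.assoc k H H V ((Coalgebra.comul (R := k) (A := H)).rTensor V (S.coact x)) =
      S.coact.lTensor H (S.coact x)
  counit : ∀ x : V,
    TensorProduct.lid k V ((Coalgebra.counit (R := k) (A := H)).rTensor V (S.coact x)) = x

/-! ### The free braided double -/

/-- The bilinear pairing `β(f, v) = v^[-1] ⟨f, v^[0]⟩` with values in `H`. -/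
def pairing (S : ActionCoaction k H V) (f : Module.Dual k V) (x : V) : H :=
  TensorProduct.rid k H (f.lTensor H (S.coact x))

/-- The right action `f ◁ h` of `H` on the dual space, `⟨f ◁ h, v⟩ = ⟨f, h ▷ v⟩`, as a linear
map in `h`. -/
def dualAct (S : ActionCoaction k H V) (f : Module.Dual k V) : H →ₗ[k] Module.Dual k V :=
  LinearMap.compRight k f ∘ₗ S.act

end ActionCoaction

variable (k H V) in
/-- The free algebra on the space of generators `V ⊕ H ⊕ V^*`. -/
abbrev Gens : Type max u v w := TensorAlgebra k (V × H × Module.Dual k V)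

variable (k H V) in
/-- The generators from `V`. -/
def genV : V →ₗ[k] Gens k H V :=
  TensorAlgebra.ι k ∘ₗ LinearMap.inl k V (H × Module.Dual k V)

variable (k H V) in
/-- The generators from `H`. -/
def genH : H →ₗ[k] Gens k H V :=
  TensorAlgebra.ι k ∘ₗ LinearMap.inr k V (H × Module.Dual k V) ∘ₗ
    LinearMap.inl k H (Module.Dual k V)

variable (k H V) in
/-- The generators from `V^*`. -/
def genD : Module.Dual k V →ₗ[k] Gens k H V :=
  TensorAlgebra.ι k ∘ₗ LinearMap.inr k V (H × Module.Dual k V) ∘ₗ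
    LinearMap.inr k H (Module.Dual k V)

namespace ActionCoaction

/-- The defining relations of the free braided double: those of the algebra `H`, and
`h v = (h₁ ▷ v) h₂`, `f h = h₁ (f ◁ h₂)`, `f v - v f = v^[-1] ⟨f, v^[0]⟩`. -/
inductive Rel (S : ActionCoaction k H V) : Gens k H V → Gens k H V → Prop
  | one : Rel S (genH k H V 1) 1
  | mul (g h : H) : Rel S (genH k H V g * genH k H V h) (genH k H V (g * h))
  | act (h : H) (x : V) : Rel S (genH k H V h * genV k H V x)
      (LinearMap.mul' k (Gens k H V)
        (TensorProduct.map (genV k H V ∘ₗ S.act.flip x) (genH k H V)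
          (Coalgebra.comul (R := k) h)))
  | dualAct (f : Module.Dual k V) (h : H) : Rel S (genD k H V f * genH k H V h)
      (LinearMap.mul' k (Gens k H V)
        (TensorProduct.map (genH k H V) (genD k H V ∘ₗ S.dualAct f)
          (Coalgebra.comul (R := k) h)))
  | comm (f : Module.Dual k V) (x : V) :
      Rel S (genD k H V f * genV k H V x - genV k H V x * genD k H V f)
        (genH k H V (S.pairing f x))

/-- The free braided double `Ã(V, δ)`. -/
abbrev FreeDouble (S : ActionCoaction k H V) : Type max u v w := RingQuot S.Rel

/-- The canonical algebra map `T(V) → Ã(V, δ)`. -/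
def lower (S : ActionCoaction k H V) : TensorAlgebra k V →ₐ[k] S.FreeDouble :=
  TensorAlgebra.lift k ((RingQuot.mkAlgHom k S.Rel).toLinearMap ∘ₗ genV k H V)

/-- The canonical map `H → Ã(V, δ)`. -/
def middle (S : ActionCoaction k H V) : H →ₗ[k] S.FreeDouble :=
  (RingQuot.mkAlgHom k S.Rel).toLinearMap ∘ₗ genH k H V

/-- The canonical algebra map `T(V^*) → Ã(V, δ)`. -/
def upper (S : ActionCoaction k H V) : TensorAlgebra k (Module.Dual k V) →ₐ[k] S.FreeDouble :=
  TensorAlgebra.lift k ((RingQuot.mkAlgHom k S.Rel).toLinearMap ∘ₗ genD k H V)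

end ActionCoaction

variable (k) in
/-- `T^{>0}(V)`, the kernel of the augmentation `T(V) → k` that kills `V`. -/
def positivePart (V : Type w) [AddCommGroup V] [Module k V] : Submodule k (TensorAlgebra k V) :=
  LinearMap.ker (TensorAlgebra.algebraMapInv (R := k) (M := V)).toLinearMap

namespace ActionCoaction

/-- The subspace `I⁻ H T(V^*) + T(V) H I⁺` of `Ã(V, δ)`. -/
def triangularSpan (S : ActionCoaction k H V) (Im : Submodule k (TensorAlgebra k V))
    (Ip : Submodule k (TensorAlgebra k (Module.Dual k V))) : Submodule k S.FreeDouble :=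
  Im.map S.lower.toLinearMap * LinearMap.range S.middle * LinearMap.range S.upper.toLinearMap ⊔
    LinearMap.range S.lower.toLinearMap * LinearMap.range S.middle * Ip.map S.upper.toLinearMap

/-- The pair of subspaces `I⁻ ⊆ T^{>0}(V)`, `I⁺ ⊆ T^{>0}(V^*)` defines a triangular ideal, that is,
`I⁻ H T(V^*) + T(V) H I⁺` is a two-sided ideal of `Ã(V, δ)`. -/
structure IsTriangular (S : ActionCoaction k H V) (Im : Submodule k (TensorAlgebra k V))
    (Ip : Submodule k (TensorAlgebra k (Module.Dual k V))) : Prop where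
  lower_le : Im ≤ positivePart k V
  upper_le : Ip ≤ positivePart k (Module.Dual k V)
  mul_left_mem : ∀ a b : S.FreeDouble, b ∈ S.triangularSpan Im Ip → a * b ∈ S.triangularSpan Im Ip
  mul_right_mem : ∀ a b : S.FreeDouble, b ∈ S.triangularSpan Im Ip → b * a ∈ S.triangularSpan Im Ip

/-- `I(V, δ) ⊆ T(V)`: the lower component of the largest triangular ideal (the sum of all
triangular ideals) of `Ã(V, δ)`. -/
def lowerIdeal (S : ActionCoaction k H V) : Submodule k (TensorAlgebra k V) :=
  sSup {Im | ∃ Ip, S.IsTriangular Im Ip}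

end ActionCoaction

/-! ### Perfect subquotients -/

/-- `V` is a subquotient of `W` via `V --μ--> W --ν--> V`: both maps are maps of `H`-modules and
`δ_V = (id_H ⊗ ν) ∘ δ_W ∘ μ`. -/
structure IsSubquotient (S : ActionCoaction k H V) (T : ActionCoaction k H W)
    (μ : V →ₗ[k] W) (ν : W →ₗ[k] V) : Prop where
  map_act_left : ∀ (h : H) (x : V), μ (S.act h x) = T.act h (μ x)
  map_act_right : ∀ (h : H) (y : W), ν (T.act h y) = S.act h (ν y)
  coact_eq : S.coact = ν.lTensor H ∘ₗ T.coact ∘ₗ μ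

/-- `V` is a perfect subquotient of `W` via `V --μ--> W --ν--> V`: it is a subquotient and
`I(V, δ_V) = T(μ)⁻¹ I(W, δ_W)`. -/
structure IsPerfectSubquotient (S : ActionCoaction k H V) (T : ActionCoaction k H W)
    (μ : V →ₗ[k] W) (ν : W →ₗ[k] V) : Prop extends IsSubquotient S T μ ν where
  lowerIdeal_eq : S.lowerIdeal =
    T.lowerIdeal.comap (TensorAlgebra.lift k (TensorAlgebra.ι k ∘ₗ μ)).toLinearMap

/-! ### The Yetter–Drinfeld module `Y(V) = H ⊗ V` -/

variable (k H) in
/-- The bilinear map sending `(a, c)` to the operator `x ↦ a x S(c)` on `H`. -/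
def twoSidedMul : H →ₗ[k] H →ₗ[k] Module.End k H :=
  LinearMap.mk₂ k
    (fun a c => LinearMap.mulLeft k a ∘ₗ LinearMap.mulRight k (HopfAlgebra.antipode k c))
    (by intros; ext; simp [add_mul]) (by intros; ext; simp)
    (by intros; ext; simp [mul_add]) (by intros; ext; simp)

variable (k H) in
/-- The map `h ↦ (h₁ ⊗ h₃) ⊗ h₂`. -/
def comulOuterInner : H →ₗ[k] (H ⊗[k] H) ⊗[k] H :=
  (TensorProduct.assoc k H H H).symm.toLinearMap ∘ₗ
    (TensorProduct.comm k H H).toLinearMap.lTensor H ∘ₗ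
      (Coalgebra.comul (R := k) (A := H)).lTensor H ∘ₗ Coalgebra.comul (R := k) (A := H)

/-- `Y(V) = H ⊗ V`, with `h ▷ (x ⊗ v) = h₁ x S(h₃) ⊗ h₂ ▷ v` and
`x ⊗ v ↦ x₁ ⊗ (x₂ ⊗ v)`. -/
def ActionCoaction.Y (S : ActionCoaction k H V) : ActionCoaction k H (H ⊗[k] V) where
  act := TensorProduct.homTensorHomMap (RingHom.id k) H V H V ∘ₗ
    TensorProduct.map (TensorProduct.lift (twoSidedMul k H)) S.act ∘ₗ comulOuterInner k H
  coact := (TensorProduct.assoc k H H V).toLinearMap ∘ₗ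
    (Coalgebra.comul (R := k) (A := H)).rTensor V

variable (k H V) in
/-- The map `ε ⊗ id_V : H ⊗ V → V`. -/
def counitTensor : H ⊗[k] V →ₗ[k] V :=
  (TensorProduct.lid k V).toLinearMap ∘ₗ (Coalgebra.counit (R := k) (A := H)).rTensor V

end BraidedDoubles

end

noncomputable section

namespace BraidedDoubles

/-! ### Convolution algebras of maps out of `H`, and `T(V)` as an `H`-module algebra. -/

section

variable {k : Type u} {H : Type v} {V : Type w} {W : Type w'} [Field k] [Ring H] [HopfAlgebra k H]
  [AddCommGroup V] [Module k V] [AddCommGroup W] [Module k W]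
  {E : Type*} [Semiring E] [Algebra k E] {E' : Type*} [Semiring E'] [Algebra k E']

open Coalgebra WithConv TensorProduct

/-! ### Convolution -/

/-! The proof replaces triangular ideals by a condition on `T(V)` alone. For a functional `f`, the
commutator with `f` is a derivation `b ↦ [f, b]` on `T(V)`, determined by `[f, v] = v^[-1] ⟨f,
v^[0]⟩` and with values that are represented by elements of `T(V) ⊗ H`. Call a subspace `I` of
`T^{>0}(V)` stable if `[f, I] ⊆ I ⊗ H` for all `f`. Then `I(V, δ)` is the largest stable subspace.

One half uses the representation of the free double on `T(V) ⊗ H` in which `V^*` kills the vacuum `1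
⊗ 1`: a triangular ideal sends the vacuum into `I⁻ ⊗ H`, and applying `f b` with `b ∈ I⁻` gives `[f,
b]`, so `I⁻` is stable (`IsTriangular.isStable`). Conversely, a stable `I` generates an `H`-stable
two-sided ideal `J` of `T(V)`. This `J` is again stable because `[f, h ▷ c] = h₁ [f ◁ h₂, c] S(h₃)`,
and `J H T(V^*)` is a triangular ideal (`IsStable.isInvariant_idealHull`,
`IsInvariant.isTriangular`).

Stable subspaces can be moved along `T(μ)`. Preimages are stable for every subquotient, since
functionals on `V` pull back along `ν`. Images are stable if `δ_W(μ(v)) = v^[-1]₁ ⊗ τ(v^[-1]₂ ⊗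
v^[0])` for some linear `τ`: a commutator with a functional on `W` is then a finite combination of
commutators with coordinate functionals on `V`, with maps `h ↦ h₁ γ(h₂)` applied to the factor `H`.
Maximality gives both inclusions, hence the criterion `IsSubquotient.isPerfectSubquotient`.

For `Y(V)` and `μ = δ` the criterion holds with `τ = id`; the `H`-linearity of `δ` is the
quasi-Yetter–Drinfeld axiom solved for `δ(h ▷ v)` by means of the antipode. If `H` is
finite-dimensional, `Y(V)` itself serves in the second statement. If `H` is commutative and
cocommutative, `H` acts on `Y(V)` through `V` only, so `C ⊗ V` is a Yetter–Drinfeld submodule for a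
finite-dimensional coideal `C`; it suffices that `C` contains the first legs of `δ`. -/

variable (k H) in
/-- An element `e` of an algebra as the element `h ↦ ε(h) e` of the convolution algebra. -/
def convConst (e : E) : WithConv (H →ₗ[k] E) :=
  toConv ((counit (R := k) (A := H)).smulRight e)

lemma convConst_apply (e : E) (h : H) : (convConst k H e) h = counit (R := k) h • e := rfl

lemma convConst_mul_apply (e : E) (φ : WithConv (H →ₗ[k] E)) (h : H) :
    (convConst k H e * φ) h = e * φ h := by
  rw [(ℛ k h).convMul_apply]
  conv_rhs => rw [← sum_counit_smul (R := k) (ℛ k h)]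
  simp [convConst_apply, Finset.mul_sum]

lemma sum_smul_counit {ι : Type*} {h : H} (r : Repr k h ι) :
    ∑ i ∈ r.index, counit (R := k) (r.right i) • r.left i = h := by
  have := congrArg (TensorProduct.rid k H) (sum_tmul_counit_eq (R := k) r)
  simpa only [map_sum, TensorProduct.rid_tmul, one_smul] using this

lemma mul_convConst_apply (e : E) (φ : WithConv (H →ₗ[k] E)) (h : H) :
    (φ * convConst k H e) h = φ h * e := by
  rw [(ℛ k h).convMul_apply]
  conv_rhs => rw [← sum_smul_counit (ℛ k h)]
  simp [convConst_apply, Finset.sum_mul]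

lemma convConst_mul (e e' : E) : convConst k H (e * e') = convConst k H e * convConst k H e' := by
  ext h
  rw [convConst_mul_apply, convConst_apply, convConst_apply, mul_smul_comm]

lemma convConst_add (e e' : E) : convConst k H (e + e') = convConst k H e + convConst k H e' := by
  ext h
  simp [convConst_apply]

lemma convConst_algebraMap (c : k) :
    convConst k H (algebraMap k E c) = algebraMap k (WithConv (H →ₗ[k] E)) c := by
  ext h
  rw [convConst_apply, LinearMap.convAlgebraMap_apply, Algebra.algebraMap_eq_smul_one,
    Algebra.algebraMap_eq_smul_one, smul_comm]

lemma convMul_mem (p : Submodule k E) (φ ψ : WithConv (H →ₗ[k] E))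
    (hp : ∀ g h, φ g * ψ h ∈ p) (h : H) : (φ * ψ) h ∈ p := by
  rw [(ℛ k h).convMul_apply]
  exact Submodule.sum_mem _ fun i _ => hp _ _

lemma convMul_apply_mul (φ ψ : WithConv (H →ₗ[k] E)) (g h : H) {ι κ : Type*} (r : Repr k g ι)
    (s : Repr k h κ) : (φ * ψ) (g * h) = ∑ i ∈ r.index, ∑ j ∈ s.index,
      φ (r.left i * s.left j) * ψ (r.right i * s.right j) := by
  rw [LinearMap.convMul_apply, Bialgebra.comul_mul, ← r.eq, ← s.eq]
  simp [Finset.sum_mul_sum]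

/-- Composition with an algebra map, on the convolution algebra. -/
def convPost (l : E →ₐ[k] E') : WithConv (H →ₗ[k] E) →ₐ[k] WithConv (H →ₗ[k] E') :=
  AlgHom.ofLinearMap
    ((WithConv.linearEquiv k _).symm.toLinearMap ∘ₗ LinearMap.compRight k l.toLinearMap ∘ₗ
      (WithConv.linearEquiv k _).toLinearMap)
    (by ext h; simp)
    (by
      intro φ ψ
      exact WithConv.ext (LinearMap.algHom_comp_convMul_distrib l φ ψ))

lemma convPost_apply (l : E →ₐ[k] E') (φ : WithConv (H →ₗ[k] E)) (h : H) :
    convPost l φ h = l (φ h) := rfl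

/-- An algebra map precomposed with the antipode is a right convolution inverse. -/
lemma conv_mul_antipode (a : H →ₐ[k] E) :
    toConv a.toLinearMap * toConv (a.toLinearMap ∘ₗ HopfAlgebra.antipode k) =
      (1 : WithConv (H →ₗ[k] E)) := by
  have h := congrArg (convPost a) (LinearMap.id_mul_antipode (R := k) (C := H))
  rw [map_mul, map_one] at h
  exact h

lemma conv_antipode_mul (a : H →ₐ[k] E) :
    toConv (a.toLinearMap ∘ₗ HopfAlgebra.antipode k) * toConv a.toLinearMap =
      (1 : WithConv (H →ₗ[k] E)) := by
  have h := congrArg (convPost a) (LinearMap.antipode_mul_id (R := k) (C := H))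
  rw [map_mul, map_one] at h
  exact h

/-! ### The action of `H` on `T(V)` -/

namespace ActionCoaction

variable (S : ActionCoaction k H V)

/-- The action of `H` on `T(V)`, as an algebra map from `T(V)` to the convolution algebra. -/
def tensorActConv : TensorAlgebra k V →ₐ[k] WithConv (H →ₗ[k] TensorAlgebra k V) :=
  TensorAlgebra.lift k ((WithConv.linearEquiv k _).symm.toLinearMap ∘ₗ
    LinearMap.compRight k (TensorAlgebra.ι k) ∘ₗ S.act.flip)

lemma tensorActConv_ι (x : V) (h : H) :
    S.tensorActConv (TensorAlgebra.ι k x) h = TensorAlgebra.ι k (S.act h x) := by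
  simp [tensorActConv]

lemma tensorActConv_one_right (hS : S.IsQuasiYD) (b : TensorAlgebra k V) :
    S.tensorActConv b 1 = b := by
  induction b using TensorAlgebra.induction with
  | algebraMap r => simp [Algebra.algebraMap_eq_smul_one]
  | ι x => simp [tensorActConv_ι, hS.act_one]
  | mul a b ha hb => simp [Algebra.TensorProduct.one_def, ha, hb]
  | add a b ha hb => simp [ha, hb]

lemma tensorActConv_mul_right (hS : S.IsQuasiYD) (b : TensorAlgebra k V) (g h : H) :
    S.tensorActConv b (g * h) = S.tensorActConv (S.tensorActConv b h) g := by
  induction b using TensorAlgebra.induction generalizing g h with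
  | algebraMap r =>
    simp only [Algebra.algebraMap_eq_smul_one,
      map_smul, map_one, Bialgebra.counit_mul, mul_smul, ofConv_smul, LinearMap.smul_apply,
      LinearMap.convOne_apply]
    rw [smul_comm (counit (R := k) h) (counit (R := k) g)]
  | ι x => simp [tensorActConv_ι, hS.act_mul]
  | mul a b ha hb =>
    rw [map_mul S.tensorActConv, (ℛ k h).convMul_apply, convMul_apply_mul _ _ _ _ (ℛ k g) (ℛ k h),
      map_sum, ofConv_sum, LinearMap.sum_apply, Finset.sum_comm]
    simp only [map_mul S.tensorActConv, (ℛ k g).convMul_apply, ha, hb]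
  | add a b ha hb => simp [ha, hb]

/-- The action of `H` on `T(V)`. -/
def tensorAct (hS : S.IsQuasiYD) : H →ₐ[k] Module.End k (TensorAlgebra k V) :=
  AlgHom.ofLinearMap
    ((WithConv.linearEquiv k _).toLinearMap ∘ₗ S.tensorActConv.toLinearMap).flip
    (LinearMap.ext fun b => S.tensorActConv_one_right hS b)
    (fun g h => LinearMap.ext fun b => S.tensorActConv_mul_right hS b g h)

lemma tensorAct_apply (hS : S.IsQuasiYD) (h : H) (b : TensorAlgebra k V) :
    S.tensorAct hS h b = S.tensorActConv b h := rfl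

/-! ### The space `T(V) ⊗ H` -/

variable (H V) in
/-- Left multiplication by `T(V)` on `T(V) ⊗ H`. -/
def lmulLower : TensorAlgebra k V →ₐ[k] Module.End k (TensorAlgebra k V ⊗[k] H) :=
  (Module.endTensorEndAlgHom (R := k) (S := k) (A := k)).comp <|
    Algebra.TensorProduct.includeLeft.comp (Algebra.lmul k (TensorAlgebra k V))

/-- The action `h ▷ (b ⊗ x) = h₁ ▷ b ⊗ h₂ x` of `H` on `T(V) ⊗ H`. -/
def lmulMiddle (hS : S.IsQuasiYD) : H →ₐ[k] Module.End k (TensorAlgebra k V ⊗[k] H) :=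
  (Module.endTensorEndAlgHom (R := k) (S := k) (A := k)).comp <|
    (Algebra.TensorProduct.map (S.tensorAct hS) (Algebra.lmul k H)).comp (Bialgebra.comulAlgHom k H)

end ActionCoaction

end

/-! ### Commutators `[f, b]` for covariant pairs of algebra maps. -/

section

variable {k : Type u} {H : Type v} {V : Type w} {W : Type w'} [Field k] [Ring H] [HopfAlgebra k H]
  [AddCommGroup V] [Module k V] [AddCommGroup W] [Module k W]
  {E : Type*} [Semiring E] [Algebra k E] {E' : Type*} [Semiring E'] [Algebra k E']

open Coalgebra WithConv TensorProduct

/-! ### Derivations on `T(V)` -/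

/-- The algebra map `b ↦ (l b, d b)` from `T(V)` to the trivial square zero extension, where `d` is
the derivation along `l` that extends `g`. -/
def tensorDerLift (l : TensorAlgebra k V →ₐ[k] E) (g : V →ₗ[k] E) :
    TensorAlgebra k V →ₐ[k] TrivSqZeroExt E E :=
  TensorAlgebra.lift k
    (((TrivSqZeroExt.inlAlgHom k E E).comp l).toLinearMap ∘ₗ TensorAlgebra.ι k +
      (TrivSqZeroExt.inrHom E E).restrictScalars k ∘ₗ g)

/-- The derivation of `T(V)` with values in `E`, regarded as a bimodule via `l`, that extends
`g : V → E`. -/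
def tensorDer (l : TensorAlgebra k V →ₐ[k] E) (g : V →ₗ[k] E) : TensorAlgebra k V →ₗ[k] E :=
  (TrivSqZeroExt.sndHom E E).restrictScalars k ∘ₗ (tensorDerLift l g).toLinearMap

lemma fst_tensorDerLift (l : TensorAlgebra k V →ₐ[k] E) (g : V →ₗ[k] E) (b : TensorAlgebra k V) :
    (tensorDerLift l g b).fst = l b := by
  have : (TrivSqZeroExt.fstHom k E E).comp (tensorDerLift l g) = l := by
    ext x
    simp [tensorDerLift]
  exact DFunLike.congr_fun this b

@[simp] lemma tensorDer_ι (l : TensorAlgebra k V →ₐ[k] E) (g : V →ₗ[k] E) (x : V) :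
    tensorDer l g (TensorAlgebra.ι k x) = g x := by
  simp [tensorDer, tensorDerLift]

lemma tensorDer_mul (l : TensorAlgebra k V →ₐ[k] E) (g : V →ₗ[k] E) (b c : TensorAlgebra k V) :
    tensorDer l g (b * c) = tensorDer l g b * l c + l b * tensorDer l g c := by
  simp [tensorDer, fst_tensorDerLift, add_comm]

@[simp] lemma tensorDer_one (l : TensorAlgebra k V →ₐ[k] E) (g : V →ₗ[k] E) :
    tensorDer l g 1 = 0 := by
  simp [tensorDer]

@[simp] lemma tensorDer_algebraMap (l : TensorAlgebra k V →ₐ[k] E) (g : V →ₗ[k] E) (r : k) :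
    tensorDer l g (algebraMap k _ r) = 0 := by
  rw [Algebra.algebraMap_eq_smul_one, map_smul, tensorDer_one, smul_zero]

/-- Serves to prove that the extension of `g` to a derivation is linear in `g`. -/
lemma tensorDer_unique (l : TensorAlgebra k V →ₐ[k] E) (d : TensorAlgebra k V →ₗ[k] E)
    (hd₁ : d 1 = 0) (hd : ∀ b c, d (b * c) = d b * l c + l b * d c) (b : TensorAlgebra k V) :
    d b = tensorDer l (d ∘ₗ TensorAlgebra.ι k) b := by
  induction b using TensorAlgebra.induction with
  | algebraMap r =>
    rw [tensorDer_algebraMap, Algebra.algebraMap_eq_smul_one, map_smul, hd₁, smul_zero]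
  | ι x => simp
  | mul a b ha hb => rw [hd, tensorDer_mul, ha, hb]
  | add a b ha hb => rw [map_add, map_add, ha, hb]

/-- `tensorDer` as a linear map in the values on `V`. -/
def tensorDerHom (l : TensorAlgebra k V →ₐ[k] E) :
    (V →ₗ[k] E) →ₗ[k] TensorAlgebra k V →ₗ[k] E where
  toFun := tensorDer l
  map_add' g g' := by
    refine LinearMap.ext fun b => Eq.symm ?_
    rw [tensorDer_unique l (tensorDer l g + tensorDer l g')]
    · refine congrArg (fun g => tensorDer l g b) (LinearMap.ext fun x => ?_)
      simp
    · simp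
    · intro b c
      simp only [LinearMap.add_apply, tensorDer_mul, add_mul, mul_add]
      abel
  map_smul' r g := by
    refine LinearMap.ext fun b => Eq.symm ?_
    simp only [RingHom.id_apply]
    rw [tensorDer_unique l (r • tensorDer l g)]
    · refine congrArg (fun g => tensorDer l g b) (LinearMap.ext fun x => ?_)
      simp
    · simp
    · intro b c
      simp only [LinearMap.smul_apply, tensorDer_mul, smul_add, smul_mul_assoc, mul_smul_comm]

namespace ActionCoaction

variable (S : ActionCoaction k H V)

/-! ### Covariant pairs of algebra maps -/

/-- A pair of algebra maps `l : T(V) → E`, `a : H → E` is covariant if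
`a(h) l(b) = l(h₁ ▷ b) a(h₂)`. -/
def IsCovariant (l : TensorAlgebra k V →ₐ[k] E) (a : H →ₐ[k] E) : Prop :=
  ∀ b : TensorAlgebra k V, toConv a.toLinearMap * convConst k H (l b) =
    convPost l (S.tensorActConv b) * toConv a.toLinearMap

-- In the convolution algebra, covariance is a commutation rule, which associativity carries from
-- two factors to their product; so generators suffice.
variable {S} in
lemma IsCovariant.of_ι {l : TensorAlgebra k V →ₐ[k] E} {a : H →ₐ[k] E}
    (h : ∀ x : V, toConv a.toLinearMap * convConst k H (l (TensorAlgebra.ι k x)) =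
      convPost l (S.tensorActConv (TensorAlgebra.ι k x)) * toConv a.toLinearMap) :
    S.IsCovariant l a := by
  intro b
  induction b using TensorAlgebra.induction with
  | algebraMap r =>
    rw [AlgHom.commutes, convConst_algebraMap, AlgHom.commutes, AlgHom.commutes]
    exact (Algebra.commutes _ _).symm
  | ι x => exact h x
  | mul b c hb hc =>
    rw [map_mul, convConst_mul, ← mul_assoc, hb, mul_assoc, hc, map_mul, map_mul, mul_assoc]
  | add b c hb hc =>
    rw [map_add, convConst_add, mul_add, hb, hc, map_add, map_add, add_mul]

variable (l : TensorAlgebra k V →ₐ[k] E) (a : H →ₐ[k] E)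

variable {S} {l a} in
lemma IsCovariant.mul_eq (h : S.IsCovariant l a) (b : TensorAlgebra k V) (x : H) {ι : Type*}
    (r : Repr k x ι) :
    a x * l b = ∑ i ∈ r.index, l (S.tensorActConv b (r.left i)) * a (r.right i) := by
  have := congrArg (fun φ : WithConv (H →ₗ[k] E) => φ x) (h b)
  simp only [mul_convConst_apply] at this
  rwa [r.convMul_apply] at this

/-- The derivation `b ↦ [f, b]` of `T(V)` with values in `E`, where `l : T(V) → E`,
`a : H → E` are algebra maps. -/
def der (f : Module.Dual k V) : TensorAlgebra k V →ₗ[k] E :=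
  tensorDer l (a.toLinearMap ∘ₗ (TensorProduct.rid k H).toLinearMap ∘ₗ f.lTensor H ∘ₗ S.coact)

@[simp] lemma der_ι (f : Module.Dual k V) (x : V) :
    S.der l a f (TensorAlgebra.ι k x) = a (S.pairing f x) := by
  simp [der, pairing]

lemma der_mul (f : Module.Dual k V) (b c : TensorAlgebra k V) :
    S.der l a f (b * c) = S.der l a f b * l c + l b * S.der l a f c :=
  tensorDer_mul _ _ _ _

@[simp] lemma der_one (f : Module.Dual k V) : S.der l a f 1 = 0 :=
  tensorDer_one _ _

@[simp] lemma der_algebraMap (f : Module.Dual k V) (r : k) :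
    S.der l a f (algebraMap k _ r) = 0 :=
  tensorDer_algebraMap _ _ _

/-- `der` as a linear map in the functional. -/
def derHom : Module.Dual k V →ₗ[k] TensorAlgebra k V →ₗ[k] E :=
  tensorDerHom l ∘ₗ
    (LinearMap.compRight k (a.toLinearMap ∘ₗ (TensorProduct.rid k H).toLinearMap) ∘ₗ
      LinearMap.lcomp k _ S.coact ∘ₗ LinearMap.lTensorHom H)

lemma derHom_apply (f : Module.Dual k V) : S.derHom l a f = S.der l a f := rfl

/-! ### The action of `T(V)` and `H` on `T(V) ⊗ H` -/

@[simp] lemma lmulLower_tmul (b c : TensorAlgebra k V) (x : H) :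
    lmulLower H V b (c ⊗ₜ x) = (b * c) ⊗ₜ x := by
  simp [lmulLower, Module.endTensorEndAlgHom_apply]

lemma lmulMiddle_tmul (hS : S.IsQuasiYD) (h : H) {ι : Type*} (r : Repr k h ι)
    (b : TensorAlgebra k V) (x : H) :
    S.lmulMiddle hS h (b ⊗ₜ x) =
      ∑ i ∈ r.index, S.tensorActConv b (r.left i) ⊗ₜ (r.right i * x) := by
  simp [lmulMiddle, ← r.eq, Module.endTensorEndAlgHom_apply, tensorAct_apply]

/-- The diagonal action is the convolution of `p`, acting on `T(V)`, and `q`, acting on `H`. The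
first is covariant because `T(V)` is an `H`-module algebra, and the second commutes with
multiplication by `T(V)`. -/
lemma isCovariant_lmul (hS : S.IsQuasiYD) : S.IsCovariant (lmulLower H V) (S.lmulMiddle hS) := by
  set p : H →ₐ[k] Module.End k (TensorAlgebra k V ⊗[k] H) :=
    (Module.endTensorEndAlgHom (R := k) (S := k) (A := k)).comp <|
      Algebra.TensorProduct.includeLeft.comp (S.tensorAct hS)
  set q : H →ₐ[k] Module.End k (TensorAlgebra k V ⊗[k] H) :=
    (Module.endTensorEndAlgHom (R := k) (S := k) (A := k)).comp <|
      Algebra.TensorProduct.includeRight.comp (Algebra.lmul k H)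
  have hA : toConv (S.lmulMiddle hS).toLinearMap = toConv p.toLinearMap * toConv q.toLinearMap := by
    ext h c x
    simp only [AlgebraTensorModule.curry_apply, curry_apply, LinearMap.restrictScalars_self,
      (ℛ k h).convMul_apply]
    simp [lmulMiddle_tmul _ _ _ (ℛ k h), p, q, Module.endTensorEndAlgHom_apply, tensorAct_apply]
  intro b
  have hp : toConv p.toLinearMap * convConst k H (lmulLower H V b) =
      convPost (lmulLower H V) (S.tensorActConv b) * toConv p.toLinearMap := by
    ext h c x
    rw [mul_convConst_apply, (ℛ k h).convMul_apply]
    simp [p, Module.endTensorEndAlgHom_apply, tensorAct_apply, convPost_apply,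
      (ℛ k h).convMul_apply, sum_tmul]
  have hq : toConv q.toLinearMap * convConst k H (lmulLower H V b) =
      convConst k H (lmulLower H V b) * toConv q.toLinearMap := by
    ext h c x
    rw [mul_convConst_apply, convConst_mul_apply]
    simp [q, Module.endTensorEndAlgHom_apply]
  rw [hA, mul_assoc, hq, ← mul_assoc, hp, mul_assoc]

/-- The map `b ⊗ x ↦ l(b) a(x)`. -/
def smashMap : TensorAlgebra k V ⊗[k] H →ₗ[k] E :=
  LinearMap.mul' k E ∘ₗ TensorProduct.map l.toLinearMap a.toLinearMap

@[simp] lemma smashMap_tmul (b : TensorAlgebra k V) (x : H) :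
    smashMap l a (b ⊗ₜ x) = l b * a x := by
  simp [smashMap]

lemma smashMap_lmulLower (b : TensorAlgebra k V) (m : TensorAlgebra k V ⊗[k] H) :
    smashMap l a (lmulLower H V b m) = l b * smashMap l a m := by
  induction m with
  | zero => simp
  | tmul c x => simp [mul_assoc]
  | add m n hm hn => simp [hm, hn, mul_add]

variable {S} {l a} in
lemma IsCovariant.smashMap_lmulMiddle (hla : S.IsCovariant l a) (hS : S.IsQuasiYD) (h : H)
    (m : TensorAlgebra k V ⊗[k] H) :
    smashMap l a (S.lmulMiddle hS h m) = a h * smashMap l a m := by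
  induction m with
  | zero => simp
  | tmul c x =>
    rw [S.lmulMiddle_tmul hS h (ℛ k h), smashMap_tmul, ← mul_assoc, hla.mul_eq c h (ℛ k h)]
    simp [Finset.sum_mul, mul_assoc]
  | add m n hm hn => simp [hm, hn, mul_add]

/-- The operators `[f, b]` on `T(V) ⊗ H`. -/
abbrev derOp (hS : S.IsQuasiYD) (f : Module.Dual k V) :
    TensorAlgebra k V →ₗ[k] Module.End k (TensorAlgebra k V ⊗[k] H) :=
  S.der (lmulLower H V) (S.lmulMiddle hS) f

-- Allows commutators to be computed once, in `T(V) ⊗ H`: with `m = 1 ⊗ 1`, the commutator in any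
-- covariant pair is the image of one universal element.
variable {S} {l a} in
lemma IsCovariant.smashMap_derOp (hla : S.IsCovariant l a) (hS : S.IsQuasiYD)
    (f : Module.Dual k V) (b : TensorAlgebra k V) (m : TensorAlgebra k V ⊗[k] H) :
    smashMap l a (S.derOp hS f b m) = S.der l a f b * smashMap l a m := by
  induction b using TensorAlgebra.induction generalizing m with
  | algebraMap r => simp
  | ι x => simp [hla.smashMap_lmulMiddle]
  | mul b c hb hc => simp [der_mul, hb, hc, smashMap_lmulLower, add_mul, mul_assoc]
  | add b c hb hc => simp [hb, hc, add_mul]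

/-- `[f, b]` is the operator of left multiplication by the element `[f, b] (1 ⊗ 1)`. -/
lemma derOp_eq_smashMap (hS : S.IsQuasiYD) (f : Module.Dual k V) (b : TensorAlgebra k V) :
    S.derOp hS f b = smashMap (lmulLower H V) (S.lmulMiddle hS) (S.derOp hS f b (1 ⊗ₜ 1)) := by
  rw [(S.isCovariant_lmul hS).smashMap_derOp]
  simp

end ActionCoaction

end

/-! ### The vacuum representation of the free double and stable subspaces. -/

section

variable {k : Type u} {H : Type v} {V : Type w} {W : Type w'} [Field k] [Ring H] [HopfAlgebra k H]
  [AddCommGroup V] [Module k V] [AddCommGroup W] [Module k W]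
  {E : Type*} [Semiring E] [Algebra k E]

open Coalgebra WithConv TensorProduct

namespace ActionCoaction

variable (S : ActionCoaction k H V) (l : TensorAlgebra k V →ₐ[k] E) (a : H →ₐ[k] E)

/-! ### Commuting `V^*` past `H` -/

/-- This and the next lemma apply `id ⊗ f` to the two sides of the quasi-Yetter–Drinfeld axiom,
turning it into an identity in `H` for the pairing `β`. -/
lemma pairing_compatLeft (f : Module.Dual k V) (x : V) (t : H ⊗[k] H) :
    TensorProduct.rid k H (f.lTensor H (S.compatLeft x t)) =
      LinearMap.mul' k H (TensorProduct.map ((TensorProduct.rid k H).toLinearMap ∘ₗ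
        f.lTensor H ∘ₗ S.coact ∘ₗ S.act.flip x) LinearMap.id t) := by
  induction t with
  | zero => simp
  | add s t hs ht => simp only [map_add, hs, ht]
  | tmul g h =>
    simp only [compatLeft, lift.tmul, LinearMap.mk₂_apply, TensorProduct.map_tmul, LinearMap.mul'_apply,
      LinearMap.comp_apply, LinearMap.flip_apply, LinearMap.id_apply]
    induction S.coact (S.act g x) with
    | zero => simp
    | add s t hs ht => simp only [map_add, hs, ht, add_mul]
    | tmul y v => simp

lemma pairing_compatRight (f : Module.Dual k V) (x : V) (t : H ⊗[k] H) :
    TensorProduct.rid k H (f.lTensor H (S.compatRight x t)) =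
      LinearMap.mul' k H (TensorProduct.map LinearMap.id
        ((TensorProduct.rid k H).toLinearMap ∘ₗ
          ((LinearMap.lTensorHom H).flip (S.coact x) ∘ₗ S.dualAct f)) t) := by
  induction t with
  | zero => simp
  | add s t hs ht => simp only [map_add, hs, ht]
  | tmul g h =>
    simp only [compatRight, lift.tmul, LinearMap.mk₂_apply, TensorProduct.map_tmul, LinearMap.mul'_apply,
      LinearMap.comp_apply, LinearMap.flip_apply, LinearMap.id_apply]
    induction S.coact x with
    | zero => simp
    | add s t hs ht => simp only [map_add, hs, ht, mul_add]
    | tmul y v => simp [dualAct]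

/-- `β(f, h₁ ▷ v) h₂ = h₁ β(f ◁ h₂, v)`. -/
lemma sum_pairing_act_mul (hS : S.IsQuasiYD) (f : Module.Dual k V) (x : V) (h : H) {ι : Type*}
    (r : Repr k h ι) :
    ∑ i ∈ r.index, S.pairing f (S.act (r.left i) x) * r.right i =
      ∑ i ∈ r.index, r.left i * S.pairing (S.dualAct f (r.right i)) x := by
  have := congrArg (fun t => TensorProduct.rid k H (f.lTensor H t)) (hS.compat h x)
  simp only [pairing_compatLeft, pairing_compatRight, ← r.eq] at this
  simpa [pairing] using this

/-- The map `h ↦ [f, h ▷ b]`. -/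
def derAct (f : Module.Dual k V) (b : TensorAlgebra k V) : WithConv (H →ₗ[k] E) :=
  toConv (S.der l a f ∘ₗ (S.tensorActConv b).ofConv)

/-- The map `h ↦ [f ◁ h, b]`. -/
def derDual (f : Module.Dual k V) (b : TensorAlgebra k V) : WithConv (H →ₗ[k] E) :=
  toConv ((S.derHom l a).flip b ∘ₗ S.dualAct f)

lemma derAct_mul (f : Module.Dual k V) (b c : TensorAlgebra k V) :
    S.derAct l a f (b * c) = S.derAct l a f b * convPost l (S.tensorActConv c) +
      convPost l (S.tensorActConv b) * S.derAct l a f c := by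
  ext h
  rw [ofConv_add, LinearMap.add_apply, (ℛ k h).convMul_apply, (ℛ k h).convMul_apply]
  simp only [derAct, map_mul, LinearMap.comp_apply, (ℛ k h).convMul_apply, map_sum, der_mul,
    Finset.sum_add_distrib, convPost_apply]

lemma derDual_mul (f : Module.Dual k V) (b c : TensorAlgebra k V) :
    S.derDual l a f (b * c) = S.derDual l a f b * convConst k H (l c) +
      convConst k H (l b) * S.derDual l a f c := by
  ext h
  rw [ofConv_add, LinearMap.add_apply, mul_convConst_apply, convConst_mul_apply]
  simp [derDual, derHom_apply, der_mul]

variable {S} {l a} in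
/-- `[f, h₁ ▷ b] h₂ = h₁ [f ◁ h₂, b]`. -/
lemma IsCovariant.derAct_mul_eq (hla : S.IsCovariant l a) (hS : S.IsQuasiYD) (f : Module.Dual k V)
    (b : TensorAlgebra k V) :
    S.derAct l a f b * toConv a.toLinearMap = toConv a.toLinearMap * S.derDual l a f b := by
  induction b using TensorAlgebra.induction with
  | algebraMap r =>
    have h₁ : S.derAct l a f (algebraMap k _ r) = 0 := by
      ext h
      simp [derAct, Algebra.algebraMap_eq_smul_one]
    have h₂ : S.derDual l a f (algebraMap k _ r) = 0 := by
      ext h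
      simp [derDual, derHom_apply]
    rw [h₁, h₂, zero_mul, mul_zero]
  | ι x =>
    ext h
    rw [(ℛ k h).convMul_apply, (ℛ k h).convMul_apply]
    have := congrArg a (S.sum_pairing_act_mul hS f x h (ℛ k h))
    simpa [derAct, derDual, derHom_apply, tensorActConv_ι] using this
  | mul b c hb hc =>
    -- In each Leibniz term, covariance carries `a` past the undifferentiated factor and the
    -- induction hypothesis carries it past the differentiated one.
    rw [derAct_mul, add_mul, mul_assoc, ← hla c, ← mul_assoc, hb, mul_assoc _ (S.derAct l a f c),
      hc, ← mul_assoc _ _ (S.derDual l a f c), ← hla b, derDual_mul, mul_add, mul_assoc, mul_assoc]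
  | add b c hb hc =>
    have h₁ : S.derAct l a f (b + c) = S.derAct l a f b + S.derAct l a f c := by
      ext h; simp [derAct]
    have h₂ : S.derDual l a f (b + c) = S.derDual l a f b + S.derDual l a f c := by
      ext h; simp [derDual]
    rw [h₁, h₂, add_mul, mul_add, hb, hc]

/-! ### The representation of the free braided double on `T(V) ⊗ H` -/

/-- The action of `V^*` on `T(V) ⊗ H`. -/
def upperOp (hS : S.IsQuasiYD) :
    Module.Dual k V →ₗ[k] Module.End k (TensorAlgebra k V ⊗[k] H) where
  toFun f := TensorProduct.lift
    (LinearMap.lcomp k _ (TensorProduct.mk k (TensorAlgebra k V) H 1) ∘ₗ S.derOp hS f)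
  map_add' f g := by
    ext b x
    simp [derOp, ← derHom_apply]
  map_smul' c f := by
    ext b x
    simp [derOp, ← derHom_apply]

@[simp] lemma upperOp_tmul (hS : S.IsQuasiYD) (f : Module.Dual k V) (b : TensorAlgebra k V)
    (x : H) : S.upperOp hS f (b ⊗ₜ x) = S.derOp hS f b (1 ⊗ₜ x) := by
  simp [upperOp]

lemma lmulMiddle_one_tmul (hS : S.IsQuasiYD) (h x : H) :
    S.lmulMiddle hS h (1 ⊗ₜ x) = 1 ⊗ₜ (h * x) := by
  rw [S.lmulMiddle_tmul hS h (ℛ k h)]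
  simp only [map_one, LinearMap.convOne_apply, Algebra.algebraMap_eq_smul_one, smul_tmul,
    ← tmul_sum, ← smul_mul_assoc, ← Finset.sum_mul, sum_counit_smul]

/-- The action of the generators on `T(V) ⊗ H`. -/
def gensRep (hS : S.IsQuasiYD) : Gens k H V →ₐ[k] Module.End k (TensorAlgebra k V ⊗[k] H) :=
  TensorAlgebra.lift k (LinearMap.coprod ((lmulLower H V).toLinearMap ∘ₗ TensorAlgebra.ι k)
    (LinearMap.coprod (S.lmulMiddle hS).toLinearMap (S.upperOp hS)))

@[simp] lemma gensRep_genV (hS : S.IsQuasiYD) (x : V) :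
    S.gensRep hS (genV k H V x) = lmulLower H V (TensorAlgebra.ι k x) := by
  simp [gensRep, genV]

@[simp] lemma gensRep_genH (hS : S.IsQuasiYD) (h : H) :
    S.gensRep hS (genH k H V h) = S.lmulMiddle hS h := by
  simp [gensRep, genH]

@[simp] lemma gensRep_genD (hS : S.IsQuasiYD) (f : Module.Dual k V) :
    S.gensRep hS (genD k H V f) = S.upperOp hS f := by
  simp [gensRep, genD]

lemma upperOp_mul_lmulLower_ι (hS : S.IsQuasiYD) (f : Module.Dual k V) (x : V) :
    S.upperOp hS f * lmulLower H V (TensorAlgebra.ι k x) =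
      S.lmulMiddle hS (S.pairing f x) + lmulLower H V (TensorAlgebra.ι k x) * S.upperOp hS f := by
  ext b y
  simp [der_mul]

/-- The relation `f h = h₁ (f ◁ h₂)` for the operators is `IsCovariant.derAct_mul_eq` evaluated at
`1 ⊗ y`. -/
lemma sum_lmulMiddle_mul_upperOp (hS : S.IsQuasiYD) (f : Module.Dual k V) (h : H) {ι : Type*}
    (r : Repr k h ι) :
    S.upperOp hS f * S.lmulMiddle hS h =
      ∑ i ∈ r.index, S.lmulMiddle hS (r.left i) * S.upperOp hS (S.dualAct f (r.right i)) := by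
  ext b y
  have := congrArg (fun φ => φ.ofConv h (1 ⊗ₜ y)) ((S.isCovariant_lmul hS).derAct_mul_eq hS f b)
  simp only [r.convMul_apply] at this
  simpa [S.lmulMiddle_tmul hS h r, derAct, derDual, derHom_apply, lmulMiddle_one_tmul] using this

lemma gensRep_rel (hS : S.IsQuasiYD) {p q : Gens k H V} (h : S.Rel p q) :
    S.gensRep hS p = S.gensRep hS q := by
  induction h with
  | one => simp
  | mul g h => simp
  | act h x =>
    rw [← (ℛ k h).eq]
    simp [(S.isCovariant_lmul hS).mul_eq _ h (ℛ k h), tensorActConv_ι]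
  | dualAct f h =>
    rw [← (ℛ k h).eq]
    simp [S.sum_lmulMiddle_mul_upperOp hS f h (ℛ k h)]
  | comm f x =>
    rw [map_sub, map_mul, map_mul, gensRep_genV, gensRep_genD, gensRep_genH,
      upperOp_mul_lmulLower_ι]
    exact add_sub_cancel_right (G := Module.End k (TensorAlgebra k V ⊗[k] H)) _ _

/-- The representation of the free braided double on `T(V) ⊗ H`. -/
def rep (hS : S.IsQuasiYD) : S.FreeDouble →ₐ[k] Module.End k (TensorAlgebra k V ⊗[k] H) :=
  RingQuot.liftAlgHom k ⟨S.gensRep hS, fun _ _ => S.gensRep_rel hS⟩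

lemma rep_lower (hS : S.IsQuasiYD) (b : TensorAlgebra k V) :
    S.rep hS (S.lower b) = lmulLower H V b := by
  have : (S.rep hS).comp S.lower = lmulLower H V := by
    ext x : 2
    simp [rep, lower]
  exact DFunLike.congr_fun this b

lemma rep_middle (hS : S.IsQuasiYD) (h : H) : S.rep hS (S.middle h) = S.lmulMiddle hS h := by
  simp [rep, middle]

lemma rep_upper_ι (hS : S.IsQuasiYD) (f : Module.Dual k V) :
    S.rep hS (S.upper (TensorAlgebra.ι k f)) = S.upperOp hS f := by
  simp [rep, upper]

/-- Since `[f, 1] = 0`, each `f` kills the vacuum `1 ⊗ 1`, so only the augmentation of `t` survives.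
-/
lemma rep_upper_one (hS : S.IsQuasiYD) (t : TensorAlgebra k (Module.Dual k V)) :
    S.rep hS (S.upper t) (1 ⊗ₜ 1) = TensorAlgebra.algebraMapInv t • (1 ⊗ₜ 1) := by
  induction t using TensorAlgebra.induction with
  | algebraMap r => simp [TensorAlgebra.algebraMapInv]
  | ι f =>
    simp [rep_upper_ι, TensorAlgebra.algebraMapInv]
  | mul b c hb hc => simp [hb, hc, mul_smul, mul_comm (TensorAlgebra.algebraMapInv b)]
  | add b c hb hc => simp [hb, hc, add_smul]

/-! ### Stable subspaces of `T(V)` -/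

variable (H) in
/-- The subspace `I ⊗ H` of `T(V) ⊗ H`. -/
def tensH (I : Submodule k (TensorAlgebra k V)) : Submodule k (TensorAlgebra k V ⊗[k] H) :=
  Submodule.map₂ (TensorProduct.mk k (TensorAlgebra k V) H) I ⊤

lemma tmul_mem_tensH {I : Submodule k (TensorAlgebra k V)} {b : TensorAlgebra k V} (hb : b ∈ I)
    (x : H) : b ⊗ₜ x ∈ tensH H I :=
  Submodule.apply_mem_map₂ _ hb trivial

lemma tensH_mono {I J : Submodule k (TensorAlgebra k V)} (h : I ≤ J) : tensH H I ≤ tensH H J :=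
  Submodule.map₂_le_map₂_left h

/-- A subspace `I` of `T^{>0}(V)` is stable if `[f, I] ⊆ I ⊗ H` for all functionals `f`. -/
structure IsStable (hS : S.IsQuasiYD) (I : Submodule k (TensorAlgebra k V)) : Prop where
  le_positivePart : I ≤ positivePart k V
  derOp_mem : ∀ f, ∀ b ∈ I, S.derOp hS f b (1 ⊗ₜ 1) ∈ tensH H I

lemma isStable_sSup (hS : S.IsQuasiYD) {s : Set (Submodule k (TensorAlgebra k V))}
    (h : ∀ I ∈ s, S.IsStable hS I) : S.IsStable hS (sSup s) where
  le_positivePart := sSup_le fun I hI => (h I hI).le_positivePart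
  derOp_mem f := by
    have : sSup s ≤ (tensH H (sSup s)).comap ((LinearMap.applyₗ (1 ⊗ₜ 1)) ∘ₗ S.derOp hS f) :=
      sSup_le fun I hI b hb => tensH_mono (le_sSup hI) ((h I hI).derOp_mem f b hb)
    exact this

/-- On the vacuum the summand with `I⁺` acts as zero, and the factor `T(V^*)` of the other summand
acts by scalars. -/
lemma rep_triangularSpan (hS : S.IsQuasiYD) {Im : Submodule k (TensorAlgebra k V)}
    {Ip : Submodule k (TensorAlgebra k (Module.Dual k V))}
    (hp : Ip ≤ positivePart k (Module.Dual k V)) {z : S.FreeDouble}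
    (hz : z ∈ S.triangularSpan Im Ip) : S.rep hS z (1 ⊗ₜ 1) ∈ tensH H Im := by
  suffices S.triangularSpan Im Ip ≤
      (tensH H Im).comap ((LinearMap.applyₗ (1 ⊗ₜ 1)) ∘ₗ (S.rep hS).toLinearMap) from this hz
  refine sup_le (Submodule.mul_le.2 fun y hy z hz => ?_) (Submodule.mul_le.2 fun y hy z hz => ?_)
  · obtain ⟨t, rfl⟩ := hz
    have hyt : y ∈ (tensH H Im).comap
        ((LinearMap.applyₗ (1 ⊗ₜ 1)) ∘ₗ (S.rep hS).toLinearMap) := by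
      revert y
      refine Submodule.mul_le.2 fun y hy z hz => ?_
      obtain ⟨b, hb, rfl⟩ := hy
      obtain ⟨h, rfl⟩ := hz
      simpa [rep_lower, rep_middle, lmulMiddle_one_tmul] using tmul_mem_tensH hb h
    have := Submodule.smul_mem _ (TensorAlgebra.algebraMapInv t) hyt
    simpa [rep_upper_one] using this
  · obtain ⟨t, ht, rfl⟩ := hz
    have : TensorAlgebra.algebraMapInv t = (0 : k) := hp ht
    simp [rep_upper_one, this]

lemma middle_one : S.middle 1 = 1 := by
  have := RingQuot.mkAlgHom_rel k (Rel.one (S := S))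
  simpa [middle] using this

-- For `b ∈ I⁻` the product `f b` lies in the ideal, and it takes the vacuum to `[f, b]` because `f`
-- kills the vacuum.
variable {S} in
lemma IsTriangular.isStable (hS : S.IsQuasiYD) {Im : Submodule k (TensorAlgebra k V)}
    {Ip : Submodule k (TensorAlgebra k (Module.Dual k V))} (h : S.IsTriangular Im Ip) :
    S.IsStable hS Im where
  le_positivePart := h.lower_le
  derOp_mem f b hb := by
    have hmem : S.lower b ∈ S.triangularSpan Im Ip := by
      refine Submodule.mem_sup_left ?_
      rw [← mul_one (S.lower b), ← mul_one (S.lower b * 1)]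
      refine Submodule.mul_mem_mul (Submodule.mul_mem_mul ⟨b, hb, rfl⟩ ⟨1, S.middle_one⟩)
        ⟨1, map_one S.upper⟩
    have := S.rep_triangularSpan hS h.upper_le
      (h.mul_left_mem (S.upper (TensorAlgebra.ι k f)) _ hmem)
    simpa [rep_lower, rep_upper_ι] using this

end ActionCoaction

end

/-! ### From stable subspaces to triangular ideals. -/

section

variable {k : Type u} {H : Type v} {V : Type w} {W : Type w'} [Field k] [Ring H] [HopfAlgebra k H]
  [AddCommGroup V] [Module k V] [AddCommGroup W] [Module k W]

open Coalgebra WithConv TensorProduct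

namespace ActionCoaction

variable (S : ActionCoaction k H V)

/-! ### Relations in the free braided double -/

lemma lower_ι (x : V) :
    S.lower (TensorAlgebra.ι k x) = RingQuot.mkAlgHom k S.Rel (genV k H V x) := by
  simp [lower]

lemma middle_apply (h : H) : S.middle h = RingQuot.mkAlgHom k S.Rel (genH k H V h) := rfl

lemma upper_ι (f : Module.Dual k V) :
    S.upper (TensorAlgebra.ι k f) = RingQuot.mkAlgHom k S.Rel (genD k H V f) := by
  simp [upper]

/-- `middle` as an algebra map. -/
def middleHom : H →ₐ[k] S.FreeDouble :=
  AlgHom.ofLinearMap S.middle S.middle_one fun g h => by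
    have := RingQuot.mkAlgHom_rel k (Rel.mul (S := S) g h)
    simpa [middle] using this.symm

lemma middleHom_apply (h : H) : S.middleHom h = S.middle h := rfl

lemma middle_mul (g h : H) : S.middle (g * h) = S.middle g * S.middle h :=
  map_mul S.middleHom g h

lemma middle_mul_lower_ι (h : H) (x : V) {ι : Type*} (r : Repr k h ι) :
    S.middle h * S.lower (TensorAlgebra.ι k x) =
      ∑ i ∈ r.index, S.lower (TensorAlgebra.ι k (S.act (r.left i) x)) * S.middle (r.right i) := by
  have := RingQuot.mkAlgHom_rel k (Rel.act (S := S) h x)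
  rw [← r.eq] at this
  simpa [lower_ι, middle_apply] using this

lemma upper_ι_mul_middle (f : Module.Dual k V) (h : H) {ι : Type*} (r : Repr k h ι) :
    S.upper (TensorAlgebra.ι k f) * S.middle h =
      ∑ i ∈ r.index,
        S.middle (r.left i) * S.upper (TensorAlgebra.ι k (S.dualAct f (r.right i))) := by
  have := RingQuot.mkAlgHom_rel k (Rel.dualAct (S := S) f h)
  rw [← r.eq] at this
  simpa [upper_ι, middle_apply] using this

lemma upper_ι_mul_lower_ι (f : Module.Dual k V) (x : V) :
    S.upper (TensorAlgebra.ι k f) * S.lower (TensorAlgebra.ι k x) =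
      S.lower (TensorAlgebra.ι k x) * S.upper (TensorAlgebra.ι k f) +
        S.middle (S.pairing f x) := by
  have := RingQuot.mkAlgHom_rel k (Rel.comm (S := S) f x)
  rw [map_sub, map_mul, map_mul, sub_eq_iff_eq_add'] at this
  simpa [upper_ι, lower_ι, middle_apply] using this

lemma freeDouble_induction {p : S.FreeDouble → Prop} (algebraMap : ∀ r, p (algebraMap k _ r))
    (lower : ∀ x, p (S.lower (TensorAlgebra.ι k x))) (middle : ∀ h, p (S.middle h))
    (upper : ∀ f, p (S.upper (TensorAlgebra.ι k f)))
    (mul : ∀ a b, p a → p b → p (a * b)) (add : ∀ a b, p a → p b → p (a + b))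
    (a : S.FreeDouble) : p a := by
  obtain ⟨a, rfl⟩ := RingQuot.mkAlgHom_surjective k S.Rel a
  induction a using TensorAlgebra.induction with
  | algebraMap r => rw [AlgHom.commutes]; exact algebraMap r
  | ι x =>
    have h : TensorAlgebra.ι k x = genV k H V x.1 + (genH k H V x.2.1 + genD k H V x.2.2) := by
      simp [genV, genH, genD, ← map_add]
    rw [h, map_add, map_add, ← S.lower_ι, ← S.middle_apply, ← S.upper_ι]
    exact add _ _ (lower _) (add _ _ (middle _) (upper _))
  | mul a b ha hb => rw [map_mul]; exact mul _ _ ha hb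
  | add a b ha hb => rw [map_add]; exact add _ _ ha hb

lemma isCovariant_freeDouble : S.IsCovariant S.lower S.middleHom := by
  refine IsCovariant.of_ι fun x => ?_
  ext h
  rw [mul_convConst_apply, (ℛ k h).convMul_apply]
  simpa [convPost_apply, tensorActConv_ι, middleHom_apply] using
    S.middle_mul_lower_ι h x (ℛ k h)

lemma upper_ι_mul_lower (f : Module.Dual k V) (b : TensorAlgebra k V) :
    S.upper (TensorAlgebra.ι k f) * S.lower b =
      S.lower b * S.upper (TensorAlgebra.ι k f) + S.der S.lower S.middleHom f b := by
  induction b using TensorAlgebra.induction with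
  | algebraMap r => simpa using (Algebra.commutes r (S.upper (TensorAlgebra.ι k f))).symm
  | ι x => simpa [middleHom_apply] using S.upper_ι_mul_lower_ι f x
  | mul b c hb hc =>
    rw [map_mul, ← mul_assoc, hb, add_mul, mul_assoc, hc, der_mul, mul_add, mul_assoc]
    abel
  | add b c hb hc =>
    rw [map_add, mul_add, hb, hc, map_add, add_mul]
    abel

/-! ### Triangular ideals generated by subspaces of `T(V)` -/

/-- The conditions on `I ⊆ T(V)` under which `I H T(V^*)` is a two-sided ideal. -/
structure IsInvariant (hS : S.IsQuasiYD) (I : Submodule k (TensorAlgebra k V)) : Prop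
    extends S.IsStable hS I where
  mul_left : ∀ b, ∀ c ∈ I, b * c ∈ I
  mul_right : ∀ b, ∀ c ∈ I, c * b ∈ I
  act_mem : ∀ h : H, ∀ c ∈ I, S.tensorActConv c h ∈ I

local notation "𝓥" => Submodule.map (AlgHom.toLinearMap (lower S)) (LinearMap.range (TensorAlgebra.ι k))
local notation "𝓗" => LinearMap.range (middle S)
local notation "𝓓" => Submodule.map (AlgHom.toLinearMap (upper S)) (LinearMap.range (TensorAlgebra.ι k))
local notation "𝓤" => LinearMap.range (AlgHom.toLinearMap (upper S))

lemma lower_ι_mem (x : V) : S.lower (TensorAlgebra.ι k x) ∈ 𝓥 := ⟨_, ⟨x, rfl⟩, rfl⟩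

lemma middle_mem (h : H) : S.middle h ∈ 𝓗 := ⟨h, rfl⟩

lemma upper_ι_mem (f : Module.Dual k V) : S.upper (TensorAlgebra.ι k f) ∈ 𝓓 := ⟨_, ⟨f, rfl⟩, rfl⟩

lemma range_middle_mul : 𝓗 * 𝓗 ≤ 𝓗 := by
  rw [Submodule.mul_le]
  rintro _ ⟨g, rfl⟩ _ ⟨h, rfl⟩
  exact ⟨g * h, S.middle_mul g h⟩

lemma range_upper_mul : 𝓤 * 𝓤 ≤ 𝓤 := by
  rw [Submodule.mul_le]
  rintro _ ⟨g, rfl⟩ _ ⟨h, rfl⟩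
  exact ⟨g * h, map_mul S.upper g h⟩

lemma dual_le_range_upper : 𝓓 ≤ 𝓤 := by
  rintro _ ⟨f, -, rfl⟩
  exact ⟨f, rfl⟩

lemma middle_mul_space_le : 𝓗 * 𝓥 ≤ 𝓥 * 𝓗 := by
  rw [Submodule.mul_le]
  rintro _ ⟨h, rfl⟩ _ ⟨_, ⟨x, rfl⟩, rfl⟩
  rw [AlgHom.toLinearMap_apply, S.middle_mul_lower_ι h x (ℛ k h)]
  exact Submodule.sum_mem _ fun i _ => Submodule.mul_mem_mul (S.lower_ι_mem _) (S.middle_mem _)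

lemma dual_mul_middle_le : 𝓓 * 𝓗 ≤ 𝓗 * 𝓓 := by
  rw [Submodule.mul_le]
  rintro _ ⟨_, ⟨f, rfl⟩, rfl⟩ _ ⟨h, rfl⟩
  rw [AlgHom.toLinearMap_apply, S.upper_ι_mul_middle f h (ℛ k h)]
  exact Submodule.sum_mem _ fun i _ => Submodule.mul_mem_mul (S.middle_mem _) (S.upper_ι_mem _)

lemma dual_mul_space_le : 𝓓 * 𝓥 ≤ 𝓥 * 𝓓 ⊔ 𝓗 := by
  rw [Submodule.mul_le]
  rintro _ ⟨_, ⟨f, rfl⟩, rfl⟩ _ ⟨_, ⟨x, rfl⟩, rfl⟩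
  rw [AlgHom.toLinearMap_apply, AlgHom.toLinearMap_apply, S.upper_ι_mul_lower_ι f x]
  exact Submodule.add_mem_sup (Submodule.mul_mem_mul (S.lower_ι_mem _) (S.upper_ι_mem _))
    (S.middle_mem _)

/-- Two-step induction: if `V^*` can be moved past `X` into `Y T(V^*)`, then so can `T(V^*)`. -/
lemma range_upper_mul_le {Y : Submodule k S.FreeDouble} (hY : 𝓓 * Y ≤ Y * 𝓤) : 𝓤 * Y ≤ Y * 𝓤 := by
  have h : ∀ t, ∀ y ∈ Y * 𝓤, S.upper t * y ∈ Y * 𝓤 := by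
    intro t
    induction t using TensorAlgebra.induction with
    | algebraMap r =>
      intro y hy
      rw [AlgHom.commutes, ← Algebra.smul_def]
      exact Submodule.smul_mem _ _ hy
    | ι f =>
      intro y hy
      have : 𝓓 * (Y * 𝓤) ≤ Y * 𝓤 := by
        calc 𝓓 * (Y * 𝓤) = 𝓓 * Y * 𝓤 := (mul_assoc _ _ _).symm
          _ ≤ Y * 𝓤 * 𝓤 := mul_le_mul_left hY _
          _ = Y * (𝓤 * 𝓤) := mul_assoc _ _ _
          _ ≤ Y * 𝓤 := mul_le_mul_right S.range_upper_mul _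
      exact this (Submodule.mul_mem_mul (S.upper_ι_mem f) hy)
    | mul s t hs ht =>
      intro y hy
      rw [map_mul, mul_assoc]
      exact hs _ (ht _ hy)
    | add s t hs ht =>
      intro y hy
      rw [map_add, add_mul]
      exact add_mem (hs _ hy) (ht _ hy)
  rw [Submodule.mul_le]
  rintro _ ⟨t, rfl⟩ y hy
  refine h t y ?_
  rw [← mul_one y]
  exact Submodule.mul_mem_mul hy ⟨1, map_one S.upper⟩

lemma range_upper_mul_middle_le : 𝓤 * 𝓗 ≤ 𝓗 * 𝓤 :=
  S.range_upper_mul_le <| S.dual_mul_middle_le.trans <|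
    mul_le_mul_right S.dual_le_range_upper _

/-- Commuting `V^*` past `V` produces terms in `H`, so the induction runs on `V + H`, past which
`V^*` moves without new terms. -/
lemma range_upper_mul_space_le : 𝓤 * 𝓥 ≤ (𝓥 ⊔ 𝓗) * 𝓤 := by
  refine (mul_le_mul_right (le_sup_left (b := 𝓗)) _).trans (S.range_upper_mul_le ?_)
  rw [Submodule.mul_sup, Submodule.sup_mul]
  refine sup_le (S.dual_mul_space_le.trans (sup_le_sup ?_ ?_)) (le_sup_of_le_right ?_)
  · exact mul_le_mul_right S.dual_le_range_upper _
  · intro y hy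
    rw [← mul_one y]
    exact Submodule.mul_mem_mul hy ⟨1, map_one S.upper⟩
  · exact S.dual_mul_middle_le.trans (mul_le_mul_right S.dual_le_range_upper _)

section Invariant

variable {S} {hS : S.IsQuasiYD} {I : Submodule k (TensorAlgebra k V)}

lemma IsInvariant.space_mul_le (hI : S.IsInvariant hS I) :
    𝓥 * I.map S.lower.toLinearMap ≤ I.map S.lower.toLinearMap := by
  rw [Submodule.mul_le]
  rintro _ ⟨b, -, rfl⟩ _ ⟨c, hc, rfl⟩
  exact ⟨b * c, hI.mul_left b c hc, map_mul S.lower b c⟩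

lemma IsInvariant.mul_space_le (hI : S.IsInvariant hS I) :
    I.map S.lower.toLinearMap * 𝓥 ≤ I.map S.lower.toLinearMap := by
  rw [Submodule.mul_le]
  rintro _ ⟨c, hc, rfl⟩ _ ⟨b, -, rfl⟩
  exact ⟨c * b, hI.mul_right b c hc, map_mul S.lower c b⟩

lemma IsInvariant.middle_mul_le (hI : S.IsInvariant hS I) :
    𝓗 * I.map S.lower.toLinearMap ≤ I.map S.lower.toLinearMap * 𝓗 := by
  rw [Submodule.mul_le]
  rintro _ ⟨h, rfl⟩ _ ⟨c, hc, rfl⟩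
  have := S.isCovariant_freeDouble.mul_eq c h (ℛ k h)
  rw [middleHom_apply] at this
  rw [AlgHom.toLinearMap_apply, this]
  exact Submodule.sum_mem _ fun i _ =>
    Submodule.mul_mem_mul ⟨_, hI.act_mem _ c hc, rfl⟩ (S.middle_mem _)

/-- Here `f c = c f + [f, c]`, and stability places `[f, c]` in the image of `I ⊗ H`. -/
lemma IsInvariant.dual_mul_le (hI : S.IsInvariant hS I) :
    𝓓 * I.map S.lower.toLinearMap ≤
      I.map S.lower.toLinearMap * 𝓓 ⊔ I.map S.lower.toLinearMap * 𝓗 := by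
  rw [Submodule.mul_le]
  rintro _ ⟨_, ⟨f, rfl⟩, rfl⟩ _ ⟨c, hc, rfl⟩
  rw [AlgHom.toLinearMap_apply, AlgHom.toLinearMap_apply, S.upper_ι_mul_lower f c]
  refine Submodule.add_mem_sup (Submodule.mul_mem_mul ⟨c, hc, rfl⟩ (S.upper_ι_mem _)) ?_
  have h₁ := S.isCovariant_freeDouble.smashMap_derOp hS f c (1 ⊗ₜ 1)
  rw [smashMap_tmul, map_one, map_one, mul_one, mul_one] at h₁
  rw [← h₁]
  have h₂ : tensH H I ≤ (I.map S.lower.toLinearMap * 𝓗).comap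
      (smashMap S.lower S.middleHom) := by
    refine Submodule.map₂_le.2 fun b hb x _ => ?_
    rw [TensorProduct.mk_apply, Submodule.mem_comap, smashMap_tmul]
    exact Submodule.mul_mem_mul ⟨b, hb, rfl⟩ (S.middle_mem x)
  exact h₂ (hI.derOp_mem f c hc)

/-- With `I⁺ = 0` the candidate ideal is `I H T(V^*)`. Closure is needed only under the generators
`V`, `H`, `V^*` on either side, and the reordering rules bring each product back to the order
`T(V)`, `H`, `T(V^*)`. -/
lemma IsInvariant.isTriangular (hI : S.IsInvariant hS I) : S.IsTriangular I ⊥ := by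
  have hspan : S.triangularSpan I ⊥ = I.map S.lower.toLinearMap * 𝓗 * 𝓤 := by
    rw [triangularSpan, Submodule.map_bot, Submodule.mul_bot, sup_bot_eq]
  set X := I.map S.lower.toLinearMap with hX
  have hXHU : X * 𝓗 * 𝓗 * 𝓤 ≤ X * 𝓗 * 𝓤 := by
    rw [mul_assoc X]
    exact mul_le_mul_left (mul_le_mul_right S.range_middle_mul _) _
  have hUU : X * 𝓗 * 𝓤 * 𝓤 ≤ X * 𝓗 * 𝓤 := by
    rw [mul_assoc _ 𝓤]
    exact mul_le_mul_right S.range_upper_mul _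
  have hV : 𝓥 * (X * 𝓗 * 𝓤) ≤ X * 𝓗 * 𝓤 := by
    rw [← mul_assoc, ← mul_assoc]
    exact mul_le_mul_left (mul_le_mul_left hI.space_mul_le _) _
  have hH : 𝓗 * (X * 𝓗 * 𝓤) ≤ X * 𝓗 * 𝓤 := by
    rw [← mul_assoc, ← mul_assoc]
    exact (mul_le_mul_left (mul_le_mul_left hI.middle_mul_le _) _).trans hXHU
  have hD : 𝓓 * (X * 𝓗 * 𝓤) ≤ X * 𝓗 * 𝓤 := by
    rw [← mul_assoc, ← mul_assoc]
    refine (mul_le_mul_left (mul_le_mul_left hI.dual_mul_le _) _).trans ?_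
    rw [Submodule.sup_mul, Submodule.sup_mul]
    refine sup_le ?_ hXHU
    rw [mul_assoc X]
    refine (mul_le_mul_left (mul_le_mul_right S.dual_mul_middle_le _) _).trans ?_
    rw [← mul_assoc X]
    exact (mul_le_mul_left (mul_le_mul_right S.dual_le_range_upper _) _).trans hUU
  have hV' : X * 𝓗 * 𝓤 * 𝓥 ≤ X * 𝓗 * 𝓤 := by
    rw [mul_assoc _ 𝓤]
    refine (mul_le_mul_right S.range_upper_mul_space_le _).trans ?_
    rw [← mul_assoc, Submodule.mul_sup, Submodule.sup_mul]
    refine sup_le ?_ hXHU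
    rw [mul_assoc X]
    refine (mul_le_mul_left (mul_le_mul_right S.middle_mul_space_le _) _).trans ?_
    rw [← mul_assoc X]
    exact mul_le_mul_left (mul_le_mul_left hI.mul_space_le _) _
  have hH' : X * 𝓗 * 𝓤 * 𝓗 ≤ X * 𝓗 * 𝓤 := by
    rw [mul_assoc _ 𝓤]
    refine (mul_le_mul_right S.range_upper_mul_middle_le _).trans ?_
    rw [← mul_assoc]
    exact hXHU
  have hD' : X * 𝓗 * 𝓤 * 𝓓 ≤ X * 𝓗 * 𝓤 :=
    (mul_le_mul_right S.dual_le_range_upper _).trans hUU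
  refine ⟨hI.le_positivePart, bot_le, fun a => ?_, fun a => ?_⟩
  all_goals rw [hspan]
  · induction a using S.freeDouble_induction with
    | algebraMap r => exact fun b hb => (Algebra.smul_def r b).symm ▸ Submodule.smul_mem _ r hb
    | lower x => exact fun b hb => hV (Submodule.mul_mem_mul (S.lower_ι_mem x) hb)
    | middle h => exact fun b hb => hH (Submodule.mul_mem_mul (S.middle_mem h) hb)
    | upper f => exact fun b hb => hD (Submodule.mul_mem_mul (S.upper_ι_mem f) hb)
    | mul a b ha hb => exact fun c hc => by rw [mul_assoc a]; exact ha _ (hb _ hc)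
    | add a b ha hb => exact fun c hc => by rw [add_mul]; exact add_mem (ha _ hc) (hb _ hc)
  · induction a using S.freeDouble_induction with
    | algebraMap r => exact fun b hb =>
        (Algebra.commutes r b) ▸ (Algebra.smul_def r b).symm ▸ Submodule.smul_mem _ r hb
    | lower x => exact fun b hb => hV' (Submodule.mul_mem_mul hb (S.lower_ι_mem x))
    | middle h => exact fun b hb => hH' (Submodule.mul_mem_mul hb (S.middle_mem h))
    | upper f => exact fun b hb => hD' (Submodule.mul_mem_mul hb (S.upper_ι_mem f))
    | mul a b ha hb => exact fun c hc => by rw [← mul_assoc c]; exact hb _ (ha _ hc)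
    | add a b ha hb => exact fun c hc => by rw [mul_add]; exact add_mem (ha _ hc) (hb _ hc)

end Invariant

/-! ### The invariant subspace generated by a stable subspace -/

lemma lmulLower_mem_tensH {I : Submodule k (TensorAlgebra k V)} (b : TensorAlgebra k V)
    (hI : ∀ c ∈ I, b * c ∈ I) {m : TensorAlgebra k V ⊗[k] H} (hm : m ∈ tensH H I) :
    lmulLower H V b m ∈ tensH H I := by
  suffices tensH H I ≤ (tensH H I).comap (lmulLower H V b) from this hm
  refine Submodule.map₂_le.2 fun c hc x _ => ?_
  simpa using tmul_mem_tensH (hI c hc) x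

lemma lmulLower_mem_tensH_of_mem {I : Submodule k (TensorAlgebra k V)} {b : TensorAlgebra k V}
    (hI : ∀ c, b * c ∈ I) (m : TensorAlgebra k V ⊗[k] H) : lmulLower H V b m ∈ tensH H I := by
  induction m with
  | zero => simp
  | tmul c x => simpa using tmul_mem_tensH (hI c) x
  | add m n hm hn => rw [map_add]; exact add_mem hm hn

lemma lmulMiddle_mem_tensH (hS : S.IsQuasiYD) {I : Submodule k (TensorAlgebra k V)}
    (hI : ∀ h : H, ∀ c ∈ I, S.tensorActConv c h ∈ I) (h : H) {m : TensorAlgebra k V ⊗[k] H}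
    (hm : m ∈ tensH H I) : S.lmulMiddle hS h m ∈ tensH H I := by
  suffices tensH H I ≤ (tensH H I).comap (S.lmulMiddle hS h) from this hm
  refine Submodule.map₂_le.2 fun c hc x _ => ?_
  rw [Submodule.mem_comap, TensorProduct.mk_apply, S.lmulMiddle_tmul hS h (ℛ k h)]
  exact Submodule.sum_mem _ fun i _ => tmul_mem_tensH (hI _ c hc) _

/-- The `H`-submodule of `T(V)` generated by `I`. -/
def actSpan (I : Submodule k (TensorAlgebra k V)) : Submodule k (TensorAlgebra k V) :=
  Submodule.map₂ ((WithConv.linearEquiv k _).toLinearMap ∘ₗ S.tensorActConv.toLinearMap) I ⊤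

/-- The `H`-stable ideal of `T(V)` generated by `I`. -/
def idealHull (I : Submodule k (TensorAlgebra k V)) : Submodule k (TensorAlgebra k V) :=
  ⊤ * S.actSpan I * ⊤

section Hull

variable {S} (hS : S.IsQuasiYD) {I : Submodule k (TensorAlgebra k V)}

lemma actSpan_le_iff {p : Submodule k (TensorAlgebra k V)} :
    S.actSpan I ≤ p ↔ ∀ c ∈ I, ∀ h : H, S.tensorActConv c h ∈ p :=
  Submodule.map₂_le.trans (by simp)

lemma tensorActConv_mem_actSpan {c : TensorAlgebra k V} (hc : c ∈ I) (h : H) :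
    S.tensorActConv c h ∈ S.actSpan I :=
  actSpan_le_iff.1 le_rfl c hc h

lemma mem_idealHull {c : TensorAlgebra k V} (hc : c ∈ S.actSpan I) (x y : TensorAlgebra k V) :
    x * c * y ∈ S.idealHull I :=
  Submodule.mul_mem_mul (Submodule.mul_mem_mul trivial hc) trivial

lemma idealHull_le_iff {p : Submodule k (TensorAlgebra k V)} :
    S.idealHull I ≤ p ↔ ∀ c ∈ S.actSpan I, ∀ x y, x * c * y ∈ p := by
  refine ⟨fun h c hc x y => h (mem_idealHull hc x y), fun h => ?_⟩
  refine Submodule.mul_le.2 fun z hz y _ => ?_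
  suffices ⊤ * S.actSpan I ≤ p.comap (LinearMap.mulRight k y) from this hz
  exact Submodule.mul_le.2 fun x _ c hc => h c hc x y

lemma idealHull_mul_left (b : TensorAlgebra k V) : ∀ c ∈ S.idealHull I, b * c ∈ S.idealHull I := by
  suffices S.idealHull I ≤ (S.idealHull I).comap (LinearMap.mulLeft k b) from this
  refine idealHull_le_iff.2 fun c hc x y => ?_
  simpa [mul_assoc] using mem_idealHull hc (b * x) y

lemma idealHull_mul_right (b : TensorAlgebra k V) : ∀ c ∈ S.idealHull I, c * b ∈ S.idealHull I := by
  suffices S.idealHull I ≤ (S.idealHull I).comap (LinearMap.mulRight k b) from this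
  refine idealHull_le_iff.2 fun c hc x y => ?_
  simpa [mul_assoc] using mem_idealHull hc x (y * b)

include hS in
lemma tensorActConv_actSpan (h : H) : ∀ c ∈ S.actSpan I, S.tensorActConv c h ∈ S.actSpan I := by
  suffices S.actSpan I ≤ (S.actSpan I).comap (S.tensorAct hS h) from this
  refine actSpan_le_iff.2 fun c hc g => ?_
  rw [Submodule.mem_comap, tensorAct_apply, ← S.tensorActConv_mul_right hS]
  exact tensorActConv_mem_actSpan hc _

lemma actSpan_le_idealHull : S.actSpan I ≤ S.idealHull I := fun c hc => by
  simpa using mem_idealHull hc 1 1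

include hS in
lemma le_idealHull : I ≤ S.idealHull I := fun c hc =>
  actSpan_le_idealHull (by simpa [S.tensorActConv_one_right hS] using
    tensorActConv_mem_actSpan (S := S) hc 1)

include hS in
lemma tensorActConv_idealHull (h : H) :
    ∀ c ∈ S.idealHull I, S.tensorActConv c h ∈ S.idealHull I := by
  suffices S.idealHull I ≤ (S.idealHull I).comap (S.tensorAct hS h) from this
  refine idealHull_le_iff.2 fun c hc x y => ?_
  rw [Submodule.mem_comap, tensorAct_apply, map_mul, map_mul]
  refine convMul_mem _ _ _ (fun g h => idealHull_mul_right _ _ ?_) h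
  refine convMul_mem _ _ _ (fun g h => idealHull_mul_left _ _ ?_) g
  exact actSpan_le_idealHull (tensorActConv_actSpan hS h c hc)

variable (S) in
lemma algebraMapInv_tensorActConv (b : TensorAlgebra k V) (h : H) :
    TensorAlgebra.algebraMapInv (S.tensorActConv b h) =
      counit (R := k) h * TensorAlgebra.algebraMapInv b := by
  have : (convPost TensorAlgebra.algebraMapInv).comp S.tensorActConv =
      (Algebra.ofId k (WithConv (H →ₗ[k] k))).comp TensorAlgebra.algebraMapInv := by
    ext x h
    simp [convPost_apply, tensorActConv_ι, TensorAlgebra.algebraMapInv]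
  have := congrArg (fun φ => (φ b).ofConv h) this
  simpa [convPost_apply, Algebra.ofId_apply, mul_comm] using this

lemma IsStable.derOp_tensorAct_mem (hI : S.IsStable hS I) (f : Module.Dual k V) (h : H)
    {c : TensorAlgebra k V} (hc : c ∈ I) (m : TensorAlgebra k V ⊗[k] H) :
    S.derOp hS f (S.tensorActConv c h) m ∈ tensH H (S.idealHull I) := by
  -- The operators with image in `J ⊗ H`, where `J` is the hull, are unaffected by composition with
  -- any operator on the right. Hence the antipode factor below needs no control.
  let p : Submodule k (Module.End k (TensorAlgebra k V ⊗[k] H)) :=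
    { carrier := {φ | ∀ m, φ m ∈ tensH H (S.idealHull I)}
      add_mem' := fun h₁ h₂ m => add_mem (h₁ m) (h₂ m)
      zero_mem' := fun m => zero_mem _
      smul_mem' := fun r φ h m => Submodule.smul_mem _ r (h m) }
  have hder : ∀ f : Module.Dual k V, S.derOp hS f c ∈ p := by
    intro f m
    rw [S.derOp_eq_smashMap hS f c]
    suffices tensH H I ≤ p.comap (smashMap (lmulLower H V) (S.lmulMiddle hS)) from
      this (hI.derOp_mem f c hc) m
    refine Submodule.map₂_le.2 fun b hb x _ m => ?_
    rw [TensorProduct.mk_apply, smashMap_tmul, Module.End.mul_apply]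
    exact lmulLower_mem_tensH_of_mem
      (fun c => idealHull_mul_right c b (le_idealHull hS hb)) _
  set a := S.lmulMiddle hS with ha
  -- This is `[f, h ▷ c] = h₁ [f ◁ h₂, c] S(h₃)`: the relation `[f, h₁ ▷ c] h₂ = h₁ [f ◁ h₂, c]`,
  -- convolved on the right with the inverse of `a`.
  have key : S.derAct (lmulLower H V) a f c = toConv a.toLinearMap *
      (S.derDual (lmulLower H V) a f c * toConv (a.toLinearMap ∘ₗ HopfAlgebra.antipode k)) := by
    rw [← mul_assoc, ← (S.isCovariant_lmul hS).derAct_mul_eq hS, mul_assoc, conv_mul_antipode,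
      mul_one]
  have : S.derAct (lmulLower H V) a f c h ∈ p := by
    rw [key]
    refine convMul_mem p _ _ (fun g h m => ?_) h
    have hp := convMul_mem p (S.derDual (lmulLower H V) a f c)
      (toConv (a.toLinearMap ∘ₗ HopfAlgebra.antipode k)) (fun g h m => hder _ _) h
    exact S.lmulMiddle_mem_tensH hS (tensorActConv_idealHull hS) g (hp m)
  exact this m

lemma IsStable.isInvariant_idealHull (hI : S.IsStable hS I) : S.IsInvariant hS (S.idealHull I) where
  mul_left := idealHull_mul_left
  mul_right := idealHull_mul_right
  act_mem := tensorActConv_idealHull hS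
  le_positivePart := by
    refine idealHull_le_iff.2 fun c hc x y => ?_
    have : S.actSpan I ≤ positivePart k V := actSpan_le_iff.2 fun c hc h => by
      have : TensorAlgebra.algebraMapInv c = (0 : k) := hI.le_positivePart hc
      change TensorAlgebra.algebraMapInv (S.tensorActConv c h) = (0 : k)
      rw [algebraMapInv_tensorActConv, this, mul_zero]
    have hc : TensorAlgebra.algebraMapInv c = (0 : k) := this hc
    change TensorAlgebra.algebraMapInv (x * c * y) = (0 : k)
    rw [map_mul, map_mul, hc, mul_zero, zero_mul]
  derOp_mem f := by
    set N := tensH H (S.idealHull I)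
    have hact : ∀ c ∈ S.actSpan I, ∀ m, S.derOp hS f c m ∈ N := by
      intro c hc m
      suffices S.actSpan I ≤ N.comap (LinearMap.applyₗ m ∘ₗ S.derOp hS f) from this hc
      exact actSpan_le_iff.2 fun c hc h => hI.derOp_tensorAct_mem hS f h hc m
    -- An operator `[f, x]` is built from multiplications by `T(V)` and the action of `H`, both of
    -- which preserve `J ⊗ H` for the `H`-stable ideal `J`.
    have hleft : ∀ x, ∀ m ∈ N, S.derOp hS f x m ∈ N := by
      intro x
      induction x using TensorAlgebra.induction with
      | algebraMap r => simp
      | ι x =>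
        intro m hm
        rw [derOp, der_ι]
        exact S.lmulMiddle_mem_tensH hS (tensorActConv_idealHull hS) _ hm
      | mul x y hx hy =>
        intro m hm
        rw [derOp, der_mul]
        exact add_mem (hx _ (lmulLower_mem_tensH y (idealHull_mul_left y) hm))
          (lmulLower_mem_tensH x (idealHull_mul_left x) (hy _ hm))
      | add x y hx hy =>
        intro m hm
        rw [map_add]
        exact add_mem (hx _ hm) (hy _ hm)
    suffices S.idealHull I ≤ N.comap ((LinearMap.applyₗ (1 ⊗ₜ 1)) ∘ₗ S.derOp hS f) from this
    refine idealHull_le_iff.2 fun c hc x y => ?_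
    have h₁ : S.derOp hS f (x * c * y) (1 ⊗ₜ 1) =
        S.derOp hS f x (lmulLower H V c (lmulLower H V y (1 ⊗ₜ 1))) +
          lmulLower H V x (S.derOp hS f c (lmulLower H V y (1 ⊗ₜ 1))) +
          lmulLower H V (x * c) (S.derOp hS f y (1 ⊗ₜ 1)) := by
      simp only [derOp, der_mul, map_mul, LinearMap.add_apply, Module.End.mul_apply]
    change S.derOp hS f (x * c * y) (1 ⊗ₜ 1) ∈ N
    rw [h₁]
    refine add_mem (add_mem (hleft _ _ ?_) ?_) ?_
    · refine lmulLower_mem_tensH_of_mem (fun z => ?_) _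
      simpa using mem_idealHull hc 1 z
    · exact lmulLower_mem_tensH x (idealHull_mul_left x) (hact c hc _)
    · exact lmulLower_mem_tensH_of_mem (fun z => mem_idealHull hc x z) _

lemma isStable_lowerIdeal : S.IsStable hS S.lowerIdeal :=
  S.isStable_sSup hS fun _ ⟨_, h⟩ => h.isStable hS

/-- Together with `isStable_lowerIdeal`, this characterises `I(V, δ)` as the largest stable
subspace, the only description of it used from here on. -/
lemma IsStable.le_lowerIdeal (hI : S.IsStable hS I) : I ≤ S.lowerIdeal :=
  (le_idealHull hS).trans (le_sSup ⟨⊥, (hI.isInvariant_idealHull hS).isTriangular⟩)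

end Hull

end ActionCoaction

end

/-! ### Stable subspaces under `T(μ)`, and the criterion for perfection. -/

section

variable {k : Type u} {H : Type v} {V : Type w} {W : Type w'} [Field k] [Ring H] [HopfAlgebra k H]
  [AddCommGroup V] [Module k V] [AddCommGroup W] [Module k W]

open Coalgebra WithConv TensorProduct Filter

/-- The algebra map `T(V) → T(W)` induced by a linear map. -/
abbrev tensorMap (μ : V →ₗ[k] W) : TensorAlgebra k V →ₐ[k] TensorAlgebra k W :=
  TensorAlgebra.lift k (TensorAlgebra.ι k ∘ₗ μ)

lemma algebraMapInv_tensorMap (μ : V →ₗ[k] W) (b : TensorAlgebra k V) :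
    TensorAlgebra.algebraMapInv (tensorMap μ b) = (TensorAlgebra.algebraMapInv b : k) := by
  have : TensorAlgebra.algebraMapInv.comp (tensorMap μ) =
      (TensorAlgebra.algebraMapInv : TensorAlgebra k V →ₐ[k] k) := by
    ext x
    simp [TensorAlgebra.algebraMapInv]
  exact DFunLike.congr_fun this b

/-- The map `h ↦ h₁ γ(h₂)`. -/
def rightHit (γ : H →ₗ[k] k) : H →ₗ[k] H :=
  (TensorProduct.rid k H).toLinearMap ∘ₗ γ.lTensor H ∘ₗ Coalgebra.comul

lemma rightHit_apply (γ : H →ₗ[k] k) {h : H} {ι : Type*} (r : Repr k h ι) :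
    rightHit γ h = ∑ i ∈ r.index, γ (r.right i) • r.left i := by
  simp [rightHit, ← r.eq]

/-- Since `V` may be infinite-dimensional, the expansion in a basis is stated for all sufficiently
large finite index sets; such statements combine under sums and products without naming supports. -/
lemma eventually_eq_sum_coord {N : Type*} [AddCommGroup N] [Module k N] {ι : Type*}
    (e : Module.Basis ι k V) (t : N ⊗[k] V) : ∀ᶠ F : Finset ι in atTop,
      t = ∑ j ∈ F, TensorProduct.rid k N ((e.coord j).lTensor N t) ⊗ₜ e j := by
  induction t with
  | zero => simp
  | tmul y x =>
    filter_upwards [eventually_ge_atTop (e.repr x).support] with F hF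
    have : x = ∑ j ∈ F, e.repr x j • e j := by
      conv_lhs => rw [← e.linearCombination_repr x, Finsupp.linearCombination_apply,
        Finsupp.sum_of_support_subset _ hF _ (by simp)]
    conv_lhs => rw [this]
    simp [tmul_sum, smul_tmul]
  | add s t hs ht =>
    filter_upwards [hs, ht] with F hs ht
    conv_lhs => rw [hs, ht]
    simp [add_tmul, Finset.sum_add_distrib]

namespace ActionCoaction

lemma mem_tensH_iff {I : Submodule k (TensorAlgebra k V)} {m : TensorAlgebra k V ⊗[k] H} :
    m ∈ tensH H I ↔ I.mkQ.rTensor H m = 0 := by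
  constructor
  · intro hm
    suffices tensH H I ≤ LinearMap.ker (I.mkQ.rTensor H) from this hm
    refine Submodule.map₂_le.2 fun b hb x _ => ?_
    have : I.mkQ b = 0 := by simpa using hb
    rw [LinearMap.mem_ker, TensorProduct.mk_apply, LinearMap.rTensor_tmul, this, zero_tmul]
  · intro hm
    have : m ∈ LinearMap.ker (I.mkQ.rTensor H) := hm
    rw [rTensor_mkQ] at this
    obtain ⟨z, rfl⟩ := this
    clear hm
    induction z with
    | zero => simp
    | tmul b x => simpa using tmul_mem_tensH b.2 x
    | add z z' hz hz' => rw [map_add]; exact add_mem hz hz'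

/-- The induced map `T(V)/φ⁻¹(I) → T(W)/I` is injective and stays so after tensoring with `H`, which
is flat over a field. -/
lemma mem_tensH_comap {I : Submodule k (TensorAlgebra k W)}
    (φ : TensorAlgebra k V →ₗ[k] TensorAlgebra k W) {m : TensorAlgebra k V ⊗[k] H}
    (hm : φ.rTensor H m ∈ tensH H I) : m ∈ tensH H (I.comap φ) := by
  rw [mem_tensH_iff] at hm ⊢
  have hinj : Function.Injective ((I.comap φ).mapQ I φ le_rfl) := by
    rw [← LinearMap.ker_eq_bot, Submodule.ker_mapQ, Submodule.mkQ_map_self]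
  apply Module.Flat.rTensor_preserves_injective_linearMap (M := H) _ hinj
  rw [map_zero, ← hm, ← LinearMap.comp_apply, ← LinearMap.comp_apply, ← LinearMap.rTensor_comp,
    ← LinearMap.rTensor_comp, Submodule.mapQ_mkQ]

lemma map_mem_tensH {I : Submodule k (TensorAlgebra k V)}
    (φ : TensorAlgebra k V →ₗ[k] TensorAlgebra k W) (ψ : H →ₗ[k] H)
    {m : TensorAlgebra k V ⊗[k] H} (hm : m ∈ tensH H I) :
    TensorProduct.map φ ψ m ∈ tensH H (I.map φ) := by
  suffices tensH H I ≤ (tensH H (I.map φ)).comap (TensorProduct.map φ ψ) from this hm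
  refine Submodule.map₂_le.2 fun b hb x _ => ?_
  exact tmul_mem_tensH (Submodule.mem_map_of_mem hb) (ψ x)

variable {S : ActionCoaction k H V} {T : ActionCoaction k H W} {μ : V →ₗ[k] W}

lemma tensorActConv_tensorMap (hμ : ∀ (h : H) (x : V), μ (S.act h x) = T.act h (μ x))
    (b : TensorAlgebra k V) (h : H) :
    T.tensorActConv (tensorMap μ b) h = tensorMap μ (S.tensorActConv b h) := by
  have : T.tensorActConv.comp (tensorMap μ) = (convPost (tensorMap μ)).comp S.tensorActConv := by
    ext x h
    simp [convPost_apply, tensorActConv_ι, hμ]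
  exact congrArg (fun φ => (φ b).ofConv h) this

lemma map_lmulLower (ψ : H →ₗ[k] H) (b : TensorAlgebra k V) (m : TensorAlgebra k V ⊗[k] H) :
    TensorProduct.map (tensorMap μ).toLinearMap ψ (lmulLower H V b m) =
      lmulLower H W (tensorMap μ b) (TensorProduct.map (tensorMap μ).toLinearMap ψ m) := by
  induction m with
  | zero => simp
  | tmul c x => simp
  | add m n hm hn => simp only [map_add, hm, hn]

lemma rTensor_lmulMiddle (hS : S.IsQuasiYD) (hT : T.IsQuasiYD)
    (hμ : ∀ (h : H) (x : V), μ (S.act h x) = T.act h (μ x)) (h : H)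
    (m : TensorAlgebra k V ⊗[k] H) :
    TensorProduct.map (tensorMap μ).toLinearMap LinearMap.id (S.lmulMiddle hS h m) =
      T.lmulMiddle hT h (TensorProduct.map (tensorMap μ).toLinearMap LinearMap.id m) := by
  induction m with
  | zero => simp
  | tmul c x =>
    rw [S.lmulMiddle_tmul hS h (ℛ k h), TensorProduct.map_tmul, T.lmulMiddle_tmul hT h (ℛ k h)]
    simp [tensorActConv_tensorMap hμ]
  | add m n hm hn => simp only [map_add, hm, hn]

/-! ### The pull-back of the largest triangular ideal -/

lemma pairing_comp_of_isSubquotient {ν : W →ₗ[k] V} (h : IsSubquotient S T μ ν)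
    (f : Module.Dual k V) (x : V) : T.pairing (f ∘ₗ ν) (μ x) = S.pairing f x := by
  rw [pairing, pairing, h.coact_eq, LinearMap.lTensor_comp]
  rfl

lemma rTensor_derOp {ν : W →ₗ[k] V} (h : IsSubquotient S T μ ν) (hS : S.IsQuasiYD)
    (hT : T.IsQuasiYD) (f : Module.Dual k V) (b : TensorAlgebra k V)
    (m : TensorAlgebra k V ⊗[k] H) :
    TensorProduct.map (tensorMap μ).toLinearMap LinearMap.id (S.derOp hS f b m) =
      T.derOp hT (f ∘ₗ ν) (tensorMap μ b)
        (TensorProduct.map (tensorMap μ).toLinearMap LinearMap.id m) := by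
  induction b using TensorAlgebra.induction generalizing m with
  | algebraMap r => simp
  | ι x =>
    simp [rTensor_lmulMiddle hS hT h.map_act_left, pairing_comp_of_isSubquotient h]
  | mul b c hb hc => simp [der_mul, hb, hc, map_lmulLower]
  | add b c hb hc => simp [hb, hc]

/-- By `rTensor_derOp`, `T(μ) ⊗ id` takes `[f, b]` to `[f ∘ ν, T(μ) b]`, which lies in `I ⊗ H`. -/
lemma isStable_comap {ν : W →ₗ[k] V} (h : IsSubquotient S T μ ν) (hS : S.IsQuasiYD)
    (hT : T.IsQuasiYD) {I : Submodule k (TensorAlgebra k W)} (hI : T.IsStable hT I) :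
    S.IsStable hS (I.comap (tensorMap μ).toLinearMap) where
  le_positivePart b hb := by
    have : TensorAlgebra.algebraMapInv (tensorMap μ b) = (0 : k) := hI.le_positivePart hb
    rwa [algebraMapInv_tensorMap] at this
  derOp_mem f b hb := by
    refine mem_tensH_comap _ ?_
    have := rTensor_derOp h hS hT f b (1 ⊗ₜ 1)
    rw [TensorProduct.map_tmul, AlgHom.toLinearMap_apply, map_one, LinearMap.id_apply] at this
    rw [LinearMap.rTensor, this]
    exact hI.derOp_mem _ _ hb

/-! ### The push-forward of the largest triangular ideal -/

/-- By coassociativity, `Δ(h₁ γ(h₂)) = h₁ ⊗ h₂ γ(h₃)`, so the hit can be applied to the factor `H`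
after the action. The vector must end in `⊗ 1`, because hitting does not commute with right
multiplication. -/
lemma lmulMiddle_rightHit (hS : S.IsQuasiYD) (hT : T.IsQuasiYD)
    (hμ : ∀ (h : H) (x : V), μ (S.act h x) = T.act h (μ x)) (γ : H →ₗ[k] k) (h : H)
    (c : TensorAlgebra k V) :
    T.lmulMiddle hT (rightHit γ h) (tensorMap μ c ⊗ₜ 1) =
      TensorProduct.map (tensorMap μ).toLinearMap (rightHit γ) (S.lmulMiddle hS h (c ⊗ₜ 1)) := by
  have key := congrArg (TensorProduct.map ((tensorMap μ).toLinearMap ∘ₗ (S.tensorActConv c).ofConv)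
    ((TensorProduct.rid k H).toLinearMap ∘ₗ γ.lTensor H))
    (sum_tmul_tmul_eq (ℛ k h) (fun i => ℛ k _) (fun i => ℛ k _))
  rw [S.lmulMiddle_tmul hS h (ℛ k h), rightHit_apply γ (ℛ k h)]
  simp only [map_sum, TensorProduct.map_tmul, LinearMap.comp_apply, LinearMap.lTensor_tmul,
    LinearEquiv.coe_coe, TensorProduct.rid_tmul, AlgHom.toLinearMap_apply] at key
  simp only [map_sum, map_smul, LinearMap.sum_apply, LinearMap.smul_apply,
    T.lmulMiddle_tmul hT _ (ℛ k _), TensorProduct.map_tmul, mul_one, AlgHom.toLinearMap_apply,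
    rightHit_apply γ (ℛ k _), tensorActConv_tensorMap hμ, Finset.smul_sum, ← tmul_smul, tmul_sum]
  exact key

/-- Expand `δ(x)` in the basis `e`; the functional attached to `e j` is `y ↦ g(τ(y ⊗ e j))`. -/
lemma eventually_pairing_eq_sum {τ : H ⊗[k] V →ₗ[k] W}
    (hτ : ∀ x, T.coact (μ x) = τ.lTensor H (TensorProduct.assoc k H H V
      ((Coalgebra.comul (R := k) (A := H)).rTensor V (S.coact x))))
    {ι : Type*} (e : Module.Basis ι k V) (g : Module.Dual k W) (x : V) :
    ∀ᶠ F : Finset ι in atTop, T.pairing g (μ x) =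
      ∑ j ∈ F, rightHit (g ∘ₗ τ ∘ₗ (TensorProduct.mk k H V).flip (e j))
        (S.pairing (e.coord j) x) := by
  filter_upwards [eventually_eq_sum_coord e (S.coact x)] with F hF
  rw [pairing, hτ, hF]
  simp only [map_sum]
  refine Finset.sum_congr rfl fun j _ => ?_
  rw [show TensorProduct.rid k H ((e.coord j).lTensor H (S.coact x)) = S.pairing (e.coord j) x
    from rfl, rightHit_apply _ (ℛ k _), LinearMap.rTensor_tmul, ← (ℛ k _).eq]
  simp [sum_tmul]

lemma eventually_derOp_eq_sum (hS : S.IsQuasiYD) (hT : T.IsQuasiYD)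
    (hμ : ∀ (h : H) (x : V), μ (S.act h x) = T.act h (μ x)) {τ : H ⊗[k] V →ₗ[k] W}
    (hτ : ∀ x, T.coact (μ x) = τ.lTensor H (TensorProduct.assoc k H H V
      ((Coalgebra.comul (R := k) (A := H)).rTensor V (S.coact x))))
    {ι : Type*} (e : Module.Basis ι k V) (g : Module.Dual k W) (b : TensorAlgebra k V) :
    ∀ᶠ F : Finset ι in atTop, ∀ c, T.derOp hT g (tensorMap μ b) (tensorMap μ c ⊗ₜ 1) =
      ∑ j ∈ F, TensorProduct.map (tensorMap μ).toLinearMap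
        (rightHit (g ∘ₗ τ ∘ₗ (TensorProduct.mk k H V).flip (e j)))
          (S.derOp hS (e.coord j) b (c ⊗ₜ 1)) := by
  induction b using TensorAlgebra.induction with
  | algebraMap r => simp
  | ι x =>
    filter_upwards [eventually_pairing_eq_sum hτ e g x] with F hF c
    simp only [derOp, TensorAlgebra.lift_ι_apply, LinearMap.comp_apply, der_ι, hF, map_sum,
      LinearMap.sum_apply, lmulMiddle_rightHit hS hT hμ]
  | mul b b' hb hb' =>
    filter_upwards [hb, hb'] with F hb hb' c
    -- In `[g, b b'] = [g, b] b' + b [g, b']` the first operator meets `b' c`, which is why the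
    -- claim is proved for all `c` and a common `F`.
    have h₁ := hb (b' * c)
    simp only [map_mul (tensorMap μ), der_mul, LinearMap.add_apply, Module.End.mul_apply,
      lmulLower_tmul, map_add, Finset.sum_add_distrib, map_lmulLower] at h₁ ⊢
    rw [h₁, hb', map_sum]
  | add b b' hb hb' =>
    filter_upwards [hb, hb'] with F hb hb' c
    simp only [map_add, LinearMap.add_apply, hb, hb', Finset.sum_add_distrib]

lemma isStable_map (hS : S.IsQuasiYD) (hT : T.IsQuasiYD)
    (hμ : ∀ (h : H) (x : V), μ (S.act h x) = T.act h (μ x)) {τ : H ⊗[k] V →ₗ[k] W}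
    (hτ : ∀ x, T.coact (μ x) = τ.lTensor H (TensorProduct.assoc k H H V
      ((Coalgebra.comul (R := k) (A := H)).rTensor V (S.coact x))))
    {I : Submodule k (TensorAlgebra k V)} (hI : S.IsStable hS I) :
    T.IsStable hT (I.map (tensorMap μ).toLinearMap) where
  le_positivePart := by
    rintro _ ⟨b, hb, rfl⟩
    have : TensorAlgebra.algebraMapInv b = (0 : k) := hI.le_positivePart hb
    change TensorAlgebra.algebraMapInv (tensorMap μ b) = (0 : k)
    rw [algebraMapInv_tensorMap, this]
  derOp_mem g := by
    rintro _ ⟨b, hb, rfl⟩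
    obtain ⟨F, hF⟩ :=
      (eventually_derOp_eq_sum hS hT hμ hτ (Module.Basis.ofVectorSpace k V) g b).exists
    -- Only `c = 1` matters for stability; general `c` was needed for the induction.
    have := hF 1
    rw [map_one] at this
    rw [AlgHom.toLinearMap_apply, this]
    exact Submodule.sum_mem _ fun j _ => map_mem_tensH _ _ (hI.derOp_mem _ b hb)

end ActionCoaction

open ActionCoaction in
/-- A subquotient `V → W → V` such that the coaction on the image of `V` in `W` is
`v ↦ v^[-1]₁ ⊗ τ(v^[-1]₂ ⊗ v^[0])` for some linear map `τ : H ⊗ V → W` is perfect. -/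
theorem IsSubquotient.isPerfectSubquotient {S : ActionCoaction k H V} {T : ActionCoaction k H W}
    {μ : V →ₗ[k] W} {ν : W →ₗ[k] V} (h : IsSubquotient S T μ ν) (hS : S.IsQuasiYD)
    (hT : T.IsQuasiYD) (τ : H ⊗[k] V →ₗ[k] W)
    (hτ : ∀ x, T.coact (μ x) = τ.lTensor H (TensorProduct.assoc k H H V
      ((Coalgebra.comul (R := k) (A := H)).rTensor V (S.coact x)))) :
    IsPerfectSubquotient S T μ ν where
  toIsSubquotient := h
  lowerIdeal_eq := le_antisymm
    (Submodule.map_le_iff_le_comap.1 <|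
      (isStable_map hS hT h.map_act_left hτ (isStable_lowerIdeal hS)).le_lowerIdeal)
    (isStable_comap h hS hT (isStable_lowerIdeal hT)).le_lowerIdeal

end

/-! ### Convolution of operators, and the action on `Y(V)`. -/

section

variable {k : Type u} {H : Type v} {V : Type w} [Field k] [Ring H] [HopfAlgebra k H]
  [AddCommGroup V] [Module k V]
  {N : Type*} [AddCommMonoid N] [Module k N] {N' : Type*} [AddCommMonoid N'] [Module k N']
  {E : Type*} [Semiring E] [Algebra k E]

open Coalgebra WithConv TensorProduct

/-! ### Convolution of operators -/

lemma commute_convMul {φ ψ : WithConv (H →ₗ[k] E)} {c : E} (hφ : ∀ h, Commute (φ h) c)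
    (hψ : ∀ h, Commute (ψ h) c) (h : H) : Commute ((φ * ψ) h) c := by
  rw [(ℛ k h).convMul_apply]
  exact Commute.sum_left _ _ _ fun i _ => (hφ _).mul_left (hψ _)

/-- The convolution of two algebra maps with commuting images is an algebra map. -/
def convHom (f g : H →ₐ[k] E) (hfg : ∀ x y, Commute (f x) (g y)) : H →ₐ[k] E :=
  AlgHom.ofLinearMap (toConv f.toLinearMap * toConv g.toLinearMap).ofConv
    (by simp [Algebra.TensorProduct.one_def])
    (by
      intro x y
      rw [convMul_apply_mul _ _ _ _ (ℛ k x) (ℛ k y), (ℛ k x).convMul_apply,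
        (ℛ k y).convMul_apply, Finset.sum_mul_sum]
      refine Finset.sum_congr rfl fun i _ => Finset.sum_congr rfl fun j _ => ?_
      simp only [AlgHom.toLinearMap_apply, map_mul, mul_assoc]
      rw [← mul_assoc (f _) (g _) (g _), (hfg _ _).eq, mul_assoc])

/-- Lets properties of the action on `Y(V)` be checked separately on its three convolution factors.
-/
lemma convMul_intertwine (ν : N →ₗ[k] N') {φ ψ : WithConv (H →ₗ[k] Module.End k N)}
    {φ' ψ' : WithConv (H →ₗ[k] Module.End k N')} (hφ : ∀ h x, ν (φ h x) = φ' h (ν x))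
    (hψ : ∀ h x, ν (ψ h x) = ψ' h (ν x)) (h : H) (x : N) :
    ν ((φ * ψ) h x) = (φ' * ψ') h (ν x) := by
  simp [(ℛ k h).convMul_apply, hφ, hψ]

/-- If `C(h₂) B(h₁) = ε(h)`, then `C(h₃) B(h₂) A(h₁) = A(h)`. -/
lemma sum_cancel (A : H →ₗ[k] N) (B C : H →ₗ[k] Module.End k N)
    (hBC : ∀ h : H, ∑ i ∈ (ℛ k h).index, C ((ℛ k h).right i) * B ((ℛ k h).left i) =
      counit (R := k) h • 1) (h : H) {ι : Type*} (r : Repr k h ι) {κ : ι → Type*}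
    (s : ∀ i, Repr k (r.left i) (κ i)) :
    ∑ i ∈ r.index, C (r.right i) (∑ j ∈ (s i).index, B ((s i).right j) (A ((s i).left j))) =
      A h := by
  have key := congrArg (TensorProduct.lift (LinearMap.mk₂ k
    (fun (a : H) (t : H ⊗[k] H) =>
      LinearMap.mul' k (Module.End k N) (TensorProduct.map C B (TensorProduct.comm k H H t)) (A a))
    (by simp) (by simp) (by simp) (by simp)))
    (sum_tmul_tmul_eq r s (fun i => ℛ k (r.right i)))
  simp only [map_sum, lift.tmul, LinearMap.mk₂_apply, TensorProduct.comm_tmul,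
    TensorProduct.map_tmul, LinearMap.mul'_apply] at key
  simp only [map_sum, ← Module.End.mul_apply]
  refine key.trans ?_
  simp only [← LinearMap.sum_apply, hBC, LinearMap.smul_apply, Module.End.one_apply]
  simp only [← map_smul, ← map_sum, sum_smul_counit]

/-! ### The operators on `H ⊗ N` -/

variable (k H N) in
/-- Left multiplication on the first factor of `H ⊗ N`. -/
def leftMulOp : H →ₐ[k] Module.End k (H ⊗[k] N) :=
  (Module.End.rTensorAlgHom k H N).comp (Algebra.lmul k H)

variable (k H N) in
/-- Right multiplication on the first factor of `H ⊗ N`. -/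
def rightMulOp : H →ₗ[k] Module.End k (H ⊗[k] N) :=
  (Module.End.rTensorAlgHom k H N).toLinearMap ∘ₗ (LinearMap.mul k H).flip

@[simp] lemma leftMulOp_tmul (h x : H) (n : N) : leftMulOp k H N h (x ⊗ₜ n) = (h * x) ⊗ₜ n :=
  rfl

@[simp] lemma rightMulOp_tmul (h x : H) (n : N) : rightMulOp k H N h (x ⊗ₜ n) = (x * h) ⊗ₜ n :=
  rfl

variable (k H N) in
/-- Operators on the second factor of `H ⊗ N`. -/
def secondOp : Module.End k N →ₐ[k] Module.End k (H ⊗[k] N) :=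
  Module.End.lTensorAlgHom k N H

@[simp] lemma secondOp_tmul (φ : Module.End k N) (x : H) (n : N) :
    secondOp k H N φ (x ⊗ₜ n) = x ⊗ₜ φ n :=
  rfl

variable (k H N) in
/-- Right multiplication by `S(h)` on the first factor of `H ⊗ N`. -/
def antipodeMulOp : H →ₐ[k] Module.End k (H ⊗[k] N) :=
  AlgHom.ofLinearMap (rightMulOp k H N ∘ₗ HopfAlgebra.antipode k)
    (by ext x n; simp)
    (by
      intro g h
      ext x n
      simp [HopfAlgebra.antipode_mul_antidistrib, mul_assoc])

@[simp] lemma antipodeMulOp_tmul (h x : H) (n : N) :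
    antipodeMulOp k H N h (x ⊗ₜ n) = (x * HopfAlgebra.antipode k h) ⊗ₜ n := by
  simp [antipodeMulOp]

lemma sum_rightMulOp_mul_antipodeMulOp (h : H) :
    ∑ i ∈ (ℛ k h).index, rightMulOp k H N ((ℛ k h).right i) *
      antipodeMulOp k H N ((ℛ k h).left i) = counit (R := k) h • 1 := by
  ext x n
  simp only [AlgebraTensorModule.curry_apply, curry_apply, LinearMap.restrictScalars_self,
    LinearMap.sum_apply, Module.End.mul_apply, antipodeMulOp_tmul, rightMulOp_tmul, mul_assoc,
    ← sum_tmul, ← Finset.mul_sum, HopfAlgebra.sum_antipode_mul_eq_smul, LinearMap.smul_apply,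
    Module.End.one_apply, mul_smul_comm, mul_one, smul_tmul']

lemma sum_antipodeMulOp_mul_rightMulOp (h : H) :
    ∑ i ∈ (ℛ k h).index, antipodeMulOp k H N ((ℛ k h).right i) *
      rightMulOp k H N ((ℛ k h).left i) = counit (R := k) h • 1 := by
  ext x n
  simp only [AlgebraTensorModule.curry_apply, curry_apply, LinearMap.restrictScalars_self,
    LinearMap.sum_apply, Module.End.mul_apply, antipodeMulOp_tmul, rightMulOp_tmul, mul_assoc,
    ← sum_tmul, ← Finset.mul_sum, HopfAlgebra.sum_mul_antipode_eq_smul, LinearMap.smul_apply,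
    Module.End.one_apply, mul_smul_comm, mul_one, smul_tmul']

/-- `Δ(S(h)) = S(h₂) ⊗ S(h₁)`. -/
lemma comul_antipode (h : H) : comul (R := k) (HopfAlgebra.antipode k h) =
    TensorProduct.map (HopfAlgebra.antipode k) (HopfAlgebra.antipode k)
      (TensorProduct.comm k H H (comul h)) := by
  let i₁ : H →ₐ[k] H ⊗[k] H := Algebra.TensorProduct.includeLeft
  let i₂ : H →ₐ[k] H ⊗[k] H := Algebra.TensorProduct.includeRight
  have hδ : toConv (Bialgebra.comulAlgHom k H).toLinearMap =
      toConv i₁.toLinearMap * toConv i₂.toLinearMap := by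
    ext h
    rw [(ℛ k h).convMul_apply]
    simp [i₁, i₂, (ℛ k h).eq]
  have hG : toConv (TensorProduct.map (HopfAlgebra.antipode k) (HopfAlgebra.antipode k) ∘ₗ
      (TensorProduct.comm k H H).toLinearMap ∘ₗ comul) =
      toConv (i₂.toLinearMap ∘ₗ HopfAlgebra.antipode k) *
        toConv (i₁.toLinearMap ∘ₗ HopfAlgebra.antipode k) := by
    ext h
    rw [(ℛ k h).convMul_apply]
    simp [i₁, i₂, ← (ℛ k h).eq]
  -- Both sides of the claim are convolution inverses of `Δ`, one on the left and one on the right,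
  -- so they agree.
  have hinv : toConv (TensorProduct.map (HopfAlgebra.antipode k) (HopfAlgebra.antipode k) ∘ₗ
      (TensorProduct.comm k H H).toLinearMap ∘ₗ comul) *
        toConv (Bialgebra.comulAlgHom k H).toLinearMap = 1 := by
    rw [hG, hδ, mul_assoc, ← mul_assoc (toConv (i₁.toLinearMap ∘ₗ _)), conv_antipode_mul, one_mul,
      conv_antipode_mul]
  have := left_inv_eq_right_inv hinv (conv_mul_antipode (Bialgebra.comulAlgHom k H))
  exact (congrArg (fun φ => φ.ofConv h) this).symm

namespace ActionCoaction

variable (S : ActionCoaction k H V)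

/-- The action of `H` on the second factor of `H ⊗ V`. -/
def innerActOp (hS : S.IsQuasiYD) : H →ₐ[k] Module.End k (H ⊗[k] V) :=
  (secondOp k H V).comp (AlgHom.ofLinearMap S.act hS.act_one hS.act_mul)

@[simp] lemma innerActOp_tmul (hS : S.IsQuasiYD) (h x : H) (v : V) :
    S.innerActOp hS h (x ⊗ₜ v) = x ⊗ₜ S.act h v :=
  rfl

/-- The three factors are algebra maps with commuting images; this makes their convolution an
action. -/
lemma toConv_Y_act (hS : S.IsQuasiYD) : toConv S.Y.act = toConv (leftMulOp k H V).toLinearMap *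
    (toConv (S.innerActOp hS).toLinearMap * toConv (antipodeMulOp k H V).toLinearMap) := by
  ext h x v
  simp only [(ℛ k h).convMul_apply, (ℛ k _).convMul_apply, Y, comulOuterInner, ← (ℛ k h).eq,
    LinearMap.comp_apply, map_sum, LinearMap.lTensor_tmul, ← (ℛ k _).eq, tmul_sum]
  simp [twoSidedMul, homTensorHomMap_apply, Finset.mul_sum]

/-- The action of `H` on `Y(V)` as an algebra map. -/
def YActHom (hS : S.IsQuasiYD) : H →ₐ[k] Module.End k (H ⊗[k] V) :=
  convHom (leftMulOp k H V) (convHom (S.innerActOp hS) (antipodeMulOp k H V)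
      (fun g h => by ext x v; simp))
    (fun g h => (commute_convMul (fun h => by ext x v; simp)
      (fun h => by ext x v; simp [mul_assoc]) h).symm)

lemma YActHom_apply (hS : S.IsQuasiYD) (h : H) : S.YActHom hS h = S.Y.act h :=
  (congrArg (fun φ => φ.ofConv h) (S.toConv_Y_act hS)).symm

lemma Y_coact_tmul (x : H) (v : V) {ι : Type*} (r : Repr k x ι) :
    S.Y.coact (x ⊗ₜ v) = ∑ i ∈ r.index, r.left i ⊗ₜ (r.right i ⊗ₜ v) := by
  simp [Y, ← r.eq, sum_tmul]

end ActionCoaction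

end

/-! ### `Y(V)` is a Yetter–Drinfeld module, with `V` as a perfect subquotient. -/

section

variable {k : Type u} {H : Type v} {V : Type w} [Field k] [Ring H] [HopfAlgebra k H]
  [AddCommGroup V] [Module k V]

open Coalgebra WithConv TensorProduct

namespace ActionCoaction

variable (S : ActionCoaction k H V)

lemma compatLeft_comul (x : V) {h : H} {ι : Type*} (r : Repr k h ι) :
    S.compatLeft x (comul h) =
      ∑ i ∈ r.index, rightMulOp k H V (r.right i) (S.coact (S.act (r.left i) x)) := by
  rw [← r.eq, map_sum]
  rfl

lemma compatRight_comul (x : V) {h : H} {ι : Type*} (r : Repr k h ι) :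
    S.compatRight x (comul h) =
      ∑ i ∈ r.index,
        leftMulOp k H V (r.left i) ((S.act (r.right i)).lTensor H (S.coact x)) := by
  rw [← r.eq, map_sum]
  refine Finset.sum_congr rfl fun i _ => ?_
  rw [compatRight, lift.tmul, LinearMap.mk₂_apply]
  induction S.coact x with
  | zero => simp
  | tmul y v => simp
  | add s t hs ht => simp only [map_add, hs, ht]

/-! ### `Y(V)` is a Yetter–Drinfeld module -/

lemma Y_coact_leftMulOp (h : H) (y : H ⊗[k] V) :
    S.Y.coact (leftMulOp k H V h y) = (toConv (leftMulOp k H (H ⊗[k] V)).toLinearMap *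
      convPost (secondOp k H (H ⊗[k] V)) (toConv (leftMulOp k H V).toLinearMap)) h
        (S.Y.coact y) := by
  induction y with
  | zero => simp
  | tmul x v =>
    have hY : S.Y.coact ((h * x) ⊗ₜ v) = ∑ i ∈ (ℛ k h).index, ∑ j ∈ (ℛ k x).index,
        ((ℛ k h).left i * (ℛ k x).left j) ⊗ₜ (((ℛ k h).right i * (ℛ k x).right j) ⊗ₜ[k] v) := by
      simp only [Y, LinearMap.comp_apply, LinearMap.rTensor_tmul, Bialgebra.comul_mul,
        ← (ℛ k x).eq, ← (ℛ k h).eq, Finset.sum_mul_sum, sum_tmul, map_sum,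
        Algebra.TensorProduct.tmul_mul_tmul, LinearEquiv.coe_coe, TensorProduct.assoc_tmul]
    rw [leftMulOp_tmul, hY, S.Y_coact_tmul x v (ℛ k x), (ℛ k h).convMul_apply]
    simp only [convPost_apply, map_sum, LinearMap.sum_apply, Module.End.mul_apply, secondOp_tmul,
      leftMulOp_tmul, AlgHom.toLinearMap_apply]
    exact Finset.sum_comm
  | add s t hs ht => simp only [map_add, hs, ht]

lemma Y_coact_innerActOp (hS : S.IsQuasiYD) (h : H) (y : H ⊗[k] V) :
    S.Y.coact (S.innerActOp hS h y) = (convPost (secondOp k H (H ⊗[k] V))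
      (toConv (S.innerActOp hS).toLinearMap)) h (S.Y.coact y) := by
  induction y with
  | zero => simp
  | tmul x v =>
    rw [S.Y_coact_tmul x v (ℛ k x), innerActOp_tmul, S.Y_coact_tmul _ _ (ℛ k x)]
    simp [convPost_apply]
  | add s t hs ht => simp only [map_add, hs, ht]

lemma Y_coact_antipodeMulOp (h : H) (y : H ⊗[k] V) :
    S.Y.coact (antipodeMulOp k H V h y) =
      (convPost (secondOp k H (H ⊗[k] V))
        (toConv (antipodeMulOp k H V).toLinearMap) *
          toConv (antipodeMulOp k H (H ⊗[k] V)).toLinearMap) h (S.Y.coact y) := by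
  induction y with
  | zero => simp
  | tmul x v =>
    have hY : S.Y.coact ((x * HopfAlgebra.antipode k h) ⊗ₜ v) =
        ∑ i ∈ (ℛ k h).index, ∑ j ∈ (ℛ k x).index,
          ((ℛ k x).left j * HopfAlgebra.antipode k ((ℛ k h).right i)) ⊗ₜ
            (((ℛ k x).right j * HopfAlgebra.antipode k ((ℛ k h).left i)) ⊗ₜ[k] v) := by
      simp only [Y, LinearMap.comp_apply, LinearMap.rTensor_tmul, Bialgebra.comul_mul,
        comul_antipode, ← (ℛ k x).eq, ← (ℛ k h).eq, Finset.sum_mul_sum, sum_tmul, map_sum,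
        TensorProduct.comm_tmul, TensorProduct.map_tmul,
        Algebra.TensorProduct.tmul_mul_tmul, LinearEquiv.coe_coe, TensorProduct.assoc_tmul]
      exact Finset.sum_comm
    rw [antipodeMulOp_tmul, hY, S.Y_coact_tmul x v (ℛ k x), (ℛ k h).convMul_apply]
    simp only [convPost_apply, map_sum, LinearMap.sum_apply, Module.End.mul_apply, secondOp_tmul,
      antipodeMulOp_tmul, AlgHom.toLinearMap_apply]
    exact Finset.sum_comm
  | add s t hs ht => simp only [map_add, hs, ht]

/-- The Yetter–Drinfeld condition in its antipode form, `δ(h ▷ y) = h₁ y^[-1] S(h₃) ⊗ h₂ ▷ y^[0]`,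
obtained by passing the coaction through the three factors. -/
lemma Y_coact_act (hS : S.IsQuasiYD) (h : H) (y : H ⊗[k] V) :
    S.Y.coact (S.Y.act h y) = ((toConv (leftMulOp k H (H ⊗[k] V)).toLinearMap *
      convPost (secondOp k H (H ⊗[k] V)) (toConv S.Y.act)) *
        toConv (antipodeMulOp k H (H ⊗[k] V)).toLinearMap) h (S.Y.coact y) := by
  have h₁ := convMul_intertwine S.Y.coact (φ := toConv (leftMulOp k H V).toLinearMap)
    (ψ := toConv (S.innerActOp hS).toLinearMap * toConv (antipodeMulOp k H V).toLinearMap)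
    S.Y_coact_leftMulOp
    (convMul_intertwine S.Y.coact (φ := toConv (S.innerActOp hS).toLinearMap)
      (ψ := toConv (antipodeMulOp k H V).toLinearMap)
      (S.Y_coact_innerActOp hS) S.Y_coact_antipodeMulOp) h y
  rw [← S.toConv_Y_act hS] at h₁
  refine h₁.trans ?_
  rw [S.toConv_Y_act hS, map_mul, map_mul]
  simp only [mul_assoc]

theorem isYD_Y (hS : S.IsQuasiYD) : S.Y.IsYD where
  act_one := by rw [← S.YActHom_apply hS, map_one]
  act_mul g h := by simp only [← S.YActHom_apply hS, map_mul]
  compat h y := by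
    set X := toConv (leftMulOp k H (H ⊗[k] V)).toLinearMap *
      convPost (secondOp k H (H ⊗[k] V)) (toConv S.Y.act) with hX
    have hcomm : ∀ g h, X g * antipodeMulOp k H (H ⊗[k] V) h =
        antipodeMulOp k H (H ⊗[k] V) h * X g := fun g h =>
      commute_convMul (fun g => by ext x v; simp [mul_assoc])
        (fun g => TensorProduct.ext' fun x v => by simp [convPost_apply]) g
    have hright : S.Y.compatRight y (comul h) = X h (S.Y.coact y) := by
      rw [S.Y.compatRight_comul y (ℛ k h), hX, (ℛ k h).convMul_apply, LinearMap.sum_apply]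
      rfl
    rw [hright, S.Y.compatLeft_comul y (ℛ k h)]
    -- Multiplying the antipode form on the right by the last leg of `h` leaves `S(h₃) h₄`, which
    -- collapses to the counit.
    have := sum_cancel (LinearMap.applyₗ (S.Y.coact y) ∘ₗ X.ofConv)
      (antipodeMulOp k H (H ⊗[k] V)).toLinearMap (rightMulOp k H (H ⊗[k] V))
      sum_rightMulOp_mul_antipodeMulOp h (ℛ k h) (fun i => ℛ k _)
    refine Eq.trans (Finset.sum_congr rfl fun i _ => congrArg _ ?_) this
    rw [S.Y_coact_act hS, (ℛ k _).convMul_apply, LinearMap.sum_apply]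
    refine Finset.sum_congr rfl fun j _ => ?_
    exact LinearMap.congr_fun (hcomm _ _) _
  coassoc y := by
    induction y with
    | zero => simp
    | tmul x v =>
      have := congrArg (((TensorProduct.mk k H V).flip v).lTensor H |>.lTensor H)
        (sum_tmul_tmul_eq (ℛ k x) (fun i => ℛ k _) (fun i => ℛ k _))
      simp only [map_sum, LinearMap.lTensor_tmul, LinearMap.flip_apply, TensorProduct.mk_apply]
        at this
      rw [S.Y_coact_tmul x v (ℛ k x)]
      simp only [map_sum, LinearMap.lTensor_tmul, S.Y_coact_tmul _ _ (ℛ k _),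
        LinearMap.rTensor_tmul, ← (ℛ k ((ℛ k x).left _)).eq, sum_tmul, tmul_sum,
        TensorProduct.assoc_tmul]
      exact this
    | add s t hs ht => simp only [map_add, hs, ht]
  counit y := by
    induction y with
    | zero => simp
    | tmul x v =>
      rw [S.Y_coact_tmul x v (ℛ k x)]
      simp only [map_sum, LinearMap.rTensor_tmul, TensorProduct.lid_tmul, smul_tmul', ← sum_tmul,
        sum_counit_smul]
    | add s t hs ht => simp only [map_add, hs, ht]

/-! ### `V` is a perfect subquotient of `Y(V)` -/

/-- Multiplying the quasi-Yetter–Drinfeld axiom on the right by `S(h₃)` isolates `δ(h ▷ x)`, and the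
other side becomes the action on `Y(V)`. -/
lemma coact_act (hS : S.IsQuasiYD) (h : H) (x : V) :
    S.coact (S.act h x) = S.Y.act h (S.coact x) := by
  set X := toConv (leftMulOp k H V).toLinearMap * toConv (S.innerActOp hS).toLinearMap with hX
  have hcomm : ∀ g h, X g * antipodeMulOp k H V h = antipodeMulOp k H V h * X g := fun g h =>
    commute_convMul (fun g => by ext x v; simp [mul_assoc]) (fun g => by ext x v; simp) g
  have hact : S.Y.act h = (X * toConv (antipodeMulOp k H V).toLinearMap) h := by
    rw [hX, mul_assoc, ← S.toConv_Y_act hS]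
  have hXx : ∀ g, X g (S.coact x) = ∑ i ∈ (ℛ k g).index,
      rightMulOp k H V ((ℛ k g).right i) (S.coact (S.act ((ℛ k g).left i) x)) := by
    intro g
    rw [← S.compatLeft_comul x (ℛ k g), hS.compat g x, S.compatRight_comul x (ℛ k g), hX,
      (ℛ k g).convMul_apply, LinearMap.sum_apply]
    rfl
  have := sum_cancel (S.coact ∘ₗ S.act.flip x) (rightMulOp k H V)
    (antipodeMulOp k H V).toLinearMap sum_antipodeMulOp_mul_rightMulOp h (ℛ k h) (fun i => ℛ k _)
  refine this.symm.trans ?_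
  rw [hact, (ℛ k h).convMul_apply, LinearMap.sum_apply]
  refine Finset.sum_congr rfl fun i _ => ?_
  refine Eq.trans ?_ (LinearMap.congr_fun (hcomm _ _) _).symm
  rw [Module.End.mul_apply, hXx]
  rfl

@[simp] lemma counitTensor_tmul (x : H) (v : V) :
    counitTensor k H V (x ⊗ₜ v) = counit (R := k) x • v := by
  simp [counitTensor]

/-- Under `ε ⊗ id` the two multiplications on `H` become convolution units, and only the action on
`V` remains. -/
lemma counitTensor_act (hS : S.IsQuasiYD) (h : H) (y : H ⊗[k] V) :
    counitTensor k H V (S.Y.act h y) = S.act h (counitTensor k H V y) := by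
  have hp : ∀ h y, counitTensor k H V ((toConv (leftMulOp k H V).toLinearMap) h y) =
      (1 : WithConv (H →ₗ[k] Module.End k V)) h (counitTensor k H V y) := by
    intro h y
    induction y with
    | zero => simp
    | tmul x v =>
      simp only [leftMulOp_tmul, AlgHom.toLinearMap_apply, counitTensor_tmul, Bialgebra.counit_mul,
        LinearMap.convOne_apply, Algebra.algebraMap_eq_smul_one, LinearMap.smul_apply,
        Module.End.one_apply, mul_smul]
    | add s t hs ht => simp only [map_add, hs, ht]
  have hr : ∀ h y, counitTensor k H V ((toConv (antipodeMulOp k H V).toLinearMap) h y) =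
      (1 : WithConv (H →ₗ[k] Module.End k V)) h (counitTensor k H V y) := by
    intro h y
    induction y with
    | zero => simp
    | tmul x v => simp [mul_smul, Algebra.algebraMap_eq_smul_one, smul_comm (counit (R := k) x)]
    | add s t hs ht => simp only [map_add, hs, ht]
  have hq : ∀ h y, counitTensor k H V ((toConv (S.innerActOp hS).toLinearMap) h y) =
      (toConv S.act) h (counitTensor k H V y) := by
    intro h y
    induction y with
    | zero => simp
    | tmul x v => simp
    | add s t hs ht => simp only [map_add, hs, ht]
  have := convMul_intertwine (counitTensor k H V) hp
    (convMul_intertwine (counitTensor k H V) hq hr) h y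
  rwa [← S.toConv_Y_act hS, one_mul, mul_one] at this

lemma lTensor_counitTensor_Y_coact (y : H ⊗[k] V) :
    (counitTensor k H V).lTensor H (S.Y.coact y) = y := by
  induction y with
  | zero => simp
  | tmul x v =>
    rw [S.Y_coact_tmul x v (ℛ k x)]
    simp only [map_sum, LinearMap.lTensor_tmul, counitTensor_tmul, ← smul_tmul, ← sum_tmul,
      sum_smul_counit]
  | add s t hs ht => simp only [map_add, hs, ht]

theorem isPerfectSubquotient_Y (hS : S.IsQuasiYD) :
    IsPerfectSubquotient S S.Y S.coact (counitTensor k H V) := by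
  have h : IsSubquotient S S.Y S.coact (counitTensor k H V) :=
    { map_act_left := S.coact_act hS
      map_act_right := S.counitTensor_act hS
      coact_eq := LinearMap.ext fun x => (S.lTensor_counitTensor_Y_coact _).symm }
  -- The coaction of `Y(V)` is `Δ ⊗ id`, so the criterion holds with `τ = id`.
  exact h.isPerfectSubquotient hS (S.isYD_Y hS).toIsQuasiYD LinearMap.id fun x => by
    simp [Y]

end ActionCoaction

end

/-! ### Finite-dimensional Yetter–Drinfeld submodules of `Y(V)`. -/

section

variable {k : Type u} {H : Type v} {V : Type w} {W : Type w'} [Field k] [Ring H] [HopfAlgebra k H]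
  [AddCommGroup V] [Module k V] [AddCommGroup W] [Module k W]

open Coalgebra WithConv TensorProduct

/-! ### Finite-dimensional coideals -/

/-- Coassociativity makes the hits of a fixed `x` closed under further hits, so they span a coideal;
it is finite-dimensional, since only the left legs of `Δ(x)` occur. -/
lemma rightHit_rightHit (φ ψ : H →ₗ[k] k) (x : H) :
    rightHit ψ (rightHit φ x) = rightHit (toConv ψ * toConv φ).ofConv x := by
  have key := congrArg ((TensorProduct.rid k H).toLinearMap ∘ₗ
    (LinearMap.mul' k k ∘ₗ TensorProduct.map ψ φ).lTensor H)
    (sum_tmul_tmul_eq (ℛ k x) (fun i => ℛ k _) (fun i => ℛ k _))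
  simp only [map_sum, LinearMap.comp_apply, LinearMap.lTensor_tmul, TensorProduct.map_tmul,
    LinearMap.mul'_apply, LinearEquiv.coe_coe, TensorProduct.rid_tmul] at key
  rw [rightHit_apply φ (ℛ k x), rightHit_apply _ (ℛ k x)]
  simp only [map_sum, map_smul]
  simp only [rightHit_apply ψ (ℛ k _), (ℛ k _).convMul_apply, Finset.smul_sum, Finset.sum_smul,
    smul_smul]
  simp only [mul_comm (φ _)]
  exact key

/-- `rightHit` as a linear map in the functional. -/
def rightHitHom (x : H) : (H →ₗ[k] k) →ₗ[k] H where
  toFun φ := rightHit φ x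
  map_add' φ ψ := by simp [rightHit]
  map_smul' c φ := by simp [rightHit]

lemma finiteDimensional_range_rightHitHom (x : H) :
    FiniteDimensional k (LinearMap.range (rightHitHom (k := k) x)) := by
  have : LinearMap.range (rightHitHom (k := k) x) ≤
      Submodule.span k ((ℛ k x).left '' (ℛ k x).index) := by
    rintro _ ⟨φ, rfl⟩
    change rightHit φ x ∈ _
    rw [rightHit_apply φ (ℛ k x)]
    exact Submodule.sum_mem _ fun i hi =>
      Submodule.smul_mem _ _ (Submodule.subset_span ⟨i, hi, rfl⟩)
  have hfin := FiniteDimensional.span_of_finite k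
    ((ℛ k x).index.finite_toSet.image (ℛ k x).left)
  exact Submodule.finiteDimensional_of_le this

/-- Every finite subset of a coalgebra lies in a finite-dimensional right coideal. -/
lemma exists_finiteDimensional_coideal (s : Finset H) : ∃ C : Submodule k H,
    FiniteDimensional k C ∧ (∀ x ∈ s, x ∈ C) ∧
      ∀ c ∈ C, C.mkQ.rTensor H (comul (R := k) c) = 0 := by
  refine ⟨⨆ x : s, LinearMap.range (rightHitHom (k := k) (x : H)), ?_, ?_, ?_⟩
  · have := fun x : H => finiteDimensional_range_rightHitHom (k := k) x
    infer_instance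
  · intro x hx
    refine Submodule.mem_iSup_of_mem ⟨x, hx⟩ ⟨counit, ?_⟩
    change rightHit counit x = x
    rw [rightHit_apply _ (ℛ k x), sum_smul_counit]
  · set C := ⨆ x : s, LinearMap.range (rightHitHom (k := k) (x : H)) with hC
    have hstable : ∀ ψ : H →ₗ[k] k, ∀ c ∈ C, rightHit ψ c ∈ C := by
      intro ψ
      suffices C ≤ C.comap (rightHit ψ) from this
      refine iSup_le fun x => ?_
      rintro _ ⟨φ, rfl⟩
      refine Submodule.mem_iSup_of_mem x ⟨(toConv ψ * toConv φ).ofConv, ?_⟩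
      exact (rightHit_rightHit φ ψ _).symm
    intro c hc
    -- The vanishing in `H/C ⊗ H` is tested on coordinates of the second factor, each of which is
    -- the class of a hit of `c`.
    obtain ⟨F, hF⟩ := (eventually_eq_sum_coord (Module.Basis.ofVectorSpace k H)
      (C.mkQ.rTensor H (comul (R := k) c))).exists
    rw [hF]
    refine Finset.sum_eq_zero fun j _ => ?_
    have : TensorProduct.rid k (H ⧸ C) (((Module.Basis.ofVectorSpace k H).coord j).lTensor (H ⧸ C)
        (C.mkQ.rTensor H (comul (R := k) c))) =
        C.mkQ (rightHit ((Module.Basis.ofVectorSpace k H).coord j) c) := by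
      rw [rightHit_apply _ (ℛ k c), ← (ℛ k c).eq]
      simp
    rw [this, show C.mkQ _ = 0 by simpa using hstable _ c hc, zero_tmul]

/-- In a cocommutative Hopf algebra, every finite subset lies in a finite-dimensional subspace `C`
with a projection `p` onto `C` such that `Δ(C) ⊆ H ⊗ C`. -/
lemma exists_projection [IsCocomm k H] (s : Finset H) : ∃ (C : Submodule k H) (p : H →ₗ[k] C),
    FiniteDimensional k C ∧ (∀ c : C, p c = c) ∧ (∀ x ∈ s, (p x : H) = x) ∧
      ∀ c : C, (C.subtype ∘ₗ p).lTensor H (comul (R := k) (c : H)) = comul (c : H) := by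
  obtain ⟨C, hfin, hs, hC⟩ := exists_finiteDimensional_coideal (k := k) s
  obtain ⟨p, hp⟩ := LinearMap.exists_leftInverse_of_injective C.subtype C.ker_subtype
  have hp' : ∀ c : C, p c = c := fun c => LinearMap.congr_fun hp c
  refine ⟨C, p, hfin, hp', fun x hx => congrArg Subtype.val (hp' ⟨x, hs x hx⟩), fun c => ?_⟩
  have hker : comul (R := k) (c : H) ∈ LinearMap.ker (C.mkQ.rTensor H) := hC c c.2
  rw [rTensor_mkQ] at hker
  obtain ⟨t, ht⟩ := hker
  -- Cocommutativity turns `Δ(C) ⊆ C ⊗ H` into `Δ(C) ⊆ H ⊗ C`, the side that the coaction of `Y(V)`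
  -- requires.
  have ht' : C.subtype.lTensor H (TensorProduct.comm k C H t) = comul (R := k) (c : H) := by
    rw [← comm_comul, ← ht]
    clear ht
    induction t with
    | zero => simp
    | tmul x y => simp
    | add s t hs ht => simp only [map_add, hs, ht]
  rw [← ht', ← LinearMap.comp_apply, ← LinearMap.lTensor_comp, LinearMap.comp_assoc, hp,
    LinearMap.comp_id]

namespace ActionCoaction

/-! ### Yetter–Drinfeld submodules -/

lemma lTensor_rightMulOp (j : V →ₗ[k] W) (h : H) (t : H ⊗[k] V) :
    j.lTensor H (rightMulOp k H V h t) = rightMulOp k H W h (j.lTensor H t) := by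
  induction t with
  | zero => simp
  | tmul x v => simp
  | add s t hs ht => simp only [map_add, hs, ht]

lemma lTensor_leftMulOp (j : V →ₗ[k] W) (h : H) (t : H ⊗[k] V) :
    j.lTensor H (leftMulOp k H V h t) = leftMulOp k H W h (j.lTensor H t) := by
  induction t with
  | zero => simp
  | tmul x v => simp
  | add s t hs ht => simp only [map_add, hs, ht]

/-- A subspace of a Yetter–Drinfeld module that is stable under action and coaction is a
Yetter–Drinfeld module. -/
theorem IsYD.of_injective {S : ActionCoaction k H V} {T : ActionCoaction k H W} (hT : T.IsYD)
    {j : V →ₗ[k] W} (hj : Function.Injective j) (hact : ∀ h x, j (S.act h x) = T.act h (j x))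
    (hcoact : ∀ x, j.lTensor H (S.coact x) = T.coact (j x)) : S.IsYD where
  act_one := LinearMap.ext fun x => hj <| by simp [hact, hT.act_one]
  act_mul g h := LinearMap.ext fun x => hj <| by simp [hact, hT.act_mul]
  compat h x := by
    apply Module.Flat.lTensor_preserves_injective_linearMap (M := H) j hj
    have := hT.compat h (j x)
    rw [compatLeft_comul _ _ (ℛ k h), compatRight_comul _ _ (ℛ k h)] at this ⊢
    simp only [map_sum, lTensor_rightMulOp, lTensor_leftMulOp, hcoact, hact]
    rw [this]
    refine Finset.sum_congr rfl fun i _ => congrArg _ ?_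
    rw [← hcoact, ← LinearMap.lTensor_comp_apply, ← LinearMap.lTensor_comp_apply]
    exact LinearMap.congr_fun (congrArg _ (LinearMap.ext fun x => (hact _ x).symm)) _
  coassoc x := by
    apply Module.Flat.lTensor_preserves_injective_linearMap (M := H) _
      (Module.Flat.lTensor_preserves_injective_linearMap (M := H) j hj)
    have h₁ : ∀ t : H ⊗[k] V, (j.lTensor H).lTensor H (TensorProduct.assoc k H H V
        ((Coalgebra.comul (R := k) (A := H)).rTensor V t)) = TensorProduct.assoc k H H W
          ((Coalgebra.comul (R := k) (A := H)).rTensor W (j.lTensor H t)) := by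
      intro t
      induction t with
      | zero => simp
      | tmul y v => simp [← (ℛ k y).eq, sum_tmul]
      | add s t hs ht => simp only [map_add, hs, ht]
    rw [h₁, hcoact, hT.coassoc, ← hcoact, ← LinearMap.lTensor_comp_apply,
      ← LinearMap.lTensor_comp_apply]
    exact LinearMap.congr_fun (congrArg _ (LinearMap.ext fun x => (hcoact x).symm)) _
  counit x := by
    apply hj
    have h₁ : ∀ t : H ⊗[k] V, j (TensorProduct.lid k V
        ((Coalgebra.counit (R := k) (A := H)).rTensor V t)) = TensorProduct.lid k W
          ((Coalgebra.counit (R := k) (A := H)).rTensor W (j.lTensor H t)) := by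
      intro t
      induction t with
      | zero => simp
      | tmul y v => simp
      | add s t hs ht => simp only [map_add, hs, ht]
    rw [h₁, hcoact, hT.counit]

/-- `V` is a perfect subquotient of every Yetter–Drinfeld submodule `W` of `Y(V)` that contains
the image of the quasicoaction. -/
theorem isPerfectSubquotient_of_injective {S : ActionCoaction k H V} (hS : S.IsQuasiYD)
    {T : ActionCoaction k H W} {j : W →ₗ[k] H ⊗[k] V} {π : H ⊗[k] V →ₗ[k] W}
    (hπ : π ∘ₗ j = LinearMap.id) (hδ : ∀ x, j (π (S.coact x)) = S.coact x)
    (hact : ∀ h y, j (T.act h y) = S.Y.act h (j y))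
    (hcoact : ∀ y, j.lTensor H (T.coact y) = S.Y.coact (j y)) :
    T.IsYD ∧ IsPerfectSubquotient S T (π ∘ₗ S.coact) (counitTensor k H V ∘ₗ j) := by
  have hj : Function.Injective j := Function.LeftInverse.injective (LinearMap.congr_fun hπ)
  have hT : T.IsYD := (S.isYD_Y hS).of_injective hj hact hcoact
  have hcoactμ : ∀ x, j.lTensor H (T.coact (π (S.coact x))) = S.Y.coact (S.coact x) := fun x => by
    rw [hcoact, hδ]
  have hsub : IsSubquotient S T (π ∘ₗ S.coact) (counitTensor k H V ∘ₗ j) :=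
    { map_act_left := fun h x => hj <| by
        rw [LinearMap.comp_apply, LinearMap.comp_apply, hδ, hact, hδ, S.coact_act hS]
      map_act_right := fun h y => by
        rw [LinearMap.comp_apply, LinearMap.comp_apply, hact, S.counitTensor_act hS]
      coact_eq := LinearMap.ext fun x => by
        rw [LinearMap.lTensor_comp, LinearMap.comp_apply, LinearMap.comp_apply,
          LinearMap.comp_apply, LinearMap.comp_apply, hcoactμ, S.lTensor_counitTensor_Y_coact] }
  -- The map `τ` of the criterion is the projection `π`.
  refine ⟨hT, hsub.isPerfectSubquotient hS hT.toIsQuasiYD π fun x => ?_⟩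
  have h₁ : π.lTensor H (j.lTensor H (T.coact (π (S.coact x)))) = T.coact (π (S.coact x)) := by
    rw [← LinearMap.comp_apply, ← LinearMap.lTensor_comp, hπ, LinearMap.lTensor_id,
      LinearMap.id_apply]
  rw [hcoactμ] at h₁
  exact h₁.symm

/-! ### Commutative cocommutative Hopf algebras -/

/-- Cocommutativity allows the last two convolution factors to be swapped, and commutativity turns
right multiplication by `S(h)` into left multiplication, so `h₁ x S(h₂)` collapses to `ε(h) x`. -/
lemma Y_act_of_comm {S : ActionCoaction k H V} (hS : S.IsQuasiYD) (hH : ∀ a b : H, a * b = b * a)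
    [IsCocomm k H] (h : H) (x : H) (v : V) : S.Y.act h (x ⊗ₜ v) = x ⊗ₜ S.act h v := by
  have hAS : toConv (antipodeMulOp k H V).toLinearMap =
      toConv ((leftMulOp k H V).toLinearMap ∘ₗ HopfAlgebra.antipode k) := by
    ext h x v
    simp [hH x]
  have hswap : toConv (S.innerActOp hS).toLinearMap * toConv (antipodeMulOp k H V).toLinearMap =
      toConv (antipodeMulOp k H V).toLinearMap * toConv (S.innerActOp hS).toLinearMap := by
    ext h : 2
    have : ∑ i ∈ (ℛ k h).index, (ℛ k h).right i ⊗ₜ[k] (ℛ k h).left i =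
        ∑ i ∈ (ℛ k h).index, (ℛ k h).left i ⊗ₜ[k] (ℛ k h).right i := by
      have := comm_comul k h
      rw [← (ℛ k h).eq, map_sum] at this
      exact this
    have := congrArg (LinearMap.mul' k (Module.End k (H ⊗[k] V)) ∘ₗ TensorProduct.map
      (antipodeMulOp k H V).toLinearMap (S.innerActOp hS).toLinearMap) this
    simp only [map_sum, LinearMap.comp_apply, TensorProduct.map_tmul, LinearMap.mul'_apply] at this
    rw [(ℛ k h).convMul_apply, (ℛ k h).convMul_apply]
    refine Eq.trans (Finset.sum_congr rfl fun i _ => ?_) this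
    exact TensorProduct.ext' fun x v => by simp
  have := congrArg (fun φ => φ.ofConv h (x ⊗ₜ v)) (S.toConv_Y_act hS)
  rw [hswap, ← mul_assoc, hAS, conv_mul_antipode, one_mul] at this
  exact this

theorem exists_isPerfectSubquotient_of_comm {S : ActionCoaction k H V} (hS : S.IsQuasiYD)
    [FiniteDimensional k V] (hH : ∀ a b : H, a * b = b * a) [IsCocomm k H] :
    ∃ C : Submodule k H, FiniteDimensional k C ∧ ∃ T : ActionCoaction k H (C ⊗[k] V), T.IsYD ∧
      ∃ (μ : V →ₗ[k] C ⊗[k] V) (ν : C ⊗[k] V →ₗ[k] V), IsPerfectSubquotient S T μ ν := by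
  classical
  let e := Module.finBasis k V
  choose s hs using fun i => TensorProduct.exists_finset (S.coact (e i))
  -- The finite set consists of the first legs of `δ` on a basis of `V`, so that `δ(V) ⊆ C ⊗ V`.
  obtain ⟨C, p, hfin, hp, hps, hC⟩ :=
    exists_projection (k := k) (Finset.univ.biUnion fun i => (s i).image Prod.fst)
  let T : ActionCoaction k H (C ⊗[k] V) :=
    { act := LinearMap.lTensorHom C ∘ₗ S.act
      coact := (TensorProduct.assoc k H C V).toLinearMap ∘ₗ
        (p.lTensor H ∘ₗ comul ∘ₗ C.subtype).rTensor V }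
  have hδ : C.subtype.rTensor V ∘ₗ p.rTensor V ∘ₗ S.coact = S.coact := by
    refine e.ext fun i => ?_
    rw [LinearMap.comp_apply, LinearMap.comp_apply, hs i]
    simp only [map_sum, LinearMap.rTensor_tmul]
    refine Finset.sum_congr rfl fun x hx => ?_
    rw [C.subtype_apply, hps]
    exact Finset.mem_biUnion.2 ⟨i, Finset.mem_univ _, Finset.mem_image_of_mem _ hx⟩
  have hcoact : ∀ y, (C.subtype.rTensor V).lTensor H (T.coact y) =
      S.Y.coact (C.subtype.rTensor V y) := by
    intro y
    induction y with
    | zero => simp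
    | add s t hs ht => simp only [map_add, hs, ht]
    | tmul c v =>
      have hcv := congrArg (fun t => TensorProduct.assoc k H H V (t ⊗ₜ[k] v)) (hC c)
      rw [← (ℛ k (c : H)).eq] at hcv
      simp only [map_sum, sum_tmul, LinearMap.lTensor_tmul, TensorProduct.assoc_tmul] at hcv
      rw [LinearMap.rTensor_tmul, C.subtype_apply, S.Y_coact_tmul _ _ (ℛ k (c : H)), ← hcv]
      simp [T, ← (ℛ k (c : H)).eq, sum_tmul]
  obtain ⟨hT, hperf⟩ := isPerfectSubquotient_of_injective hS (T := T) (j := C.subtype.rTensor V)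
    (π := p.rTensor V) (TensorProduct.ext' fun c v => by simp [hp]) (LinearMap.congr_fun hδ)
    (fun h y => by
      induction y with
      | zero => simp
      | add s t hs ht => simp only [map_add, hs, ht]
      | tmul c v => simp [T, Y_act_of_comm hS hH]) hcoact
  exact ⟨C, hfin, T, hT, _, _, hperf⟩

end ActionCoaction

end

end BraidedDoubles

end

theorem theoremF {k : Type u} {H : Type v} {V : Type w} [Field k] [Ring H]
    [HopfAlgebra k H] [AddCommGroup V] [Module k V]
    (S : BraidedDoubles.ActionCoaction k H V) (hS : S.IsQuasiYD) :
    (S.Y.IsYD ∧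
      BraidedDoubles.IsPerfectSubquotient S S.Y S.coact (BraidedDoubles.counitTensor k H V)) ∧
    (FiniteDimensional k V →
      (FiniteDimensional k H ∨ ((∀ a b : H, a * b = b * a) ∧ Coalgebra.IsCocomm k H)) →
      ∃ (Y : Type (max v w)) (_ : AddCommGroup Y) (_ : Module k Y)
        (T : BraidedDoubles.ActionCoaction k H Y),
        FiniteDimensional k Y ∧ T.IsYD ∧
          ∃ (μ : V →ₗ[k] Y) (ν : Y →ₗ[k] V), BraidedDoubles.IsPerfectSubquotient S T μ ν) := by
  refine ⟨⟨S.isYD_Y hS, S.isPerfectSubquotient_Y hS⟩, fun hV hH => ?_⟩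
  rcases hH with hH | ⟨hcomm, hcocomm⟩
  · exact ⟨H ⊗[k] V, inferInstance, inferInstance, S.Y, inferInstance, S.isYD_Y hS, _, _,
      S.isPerfectSubquotient_Y hS⟩
  · obtain ⟨C, hC, T, hT, μ, ν, h⟩ :=
      BraidedDoubles.ActionCoaction.exists_isPerfectSubquotient_of_comm hS hcomm
    exact ⟨C ⊗[k] V, inferInstance, inferInstance, T, inferInstance, hT, μ, ν, h⟩
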